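/- Let $\mathcal S,\mathcal A,O$ be finite sets (states, actions, observations), $C:\mathcal S\times\mathcal A\to[0,1]$ a cost function, $\eta(\cdot\mid s)$ a known observation kernel, and $\Theta$ a finite set of transition kernels $\theta(s'\mid s,a)$. Let $f$ be a probability mass function on $\Theta$ (the prior) and, for $\theta\in\Theta$, let $h(\cdot;\theta)$ be a probability distribution on $\mathcal S$ (the law of the initial state). Let $\Delta_{\mathcal S}$ be the set of probability distributions on $\mathcal S$. **Notation.** For $b\in\Delta_{\mathcal S}$ put $P(o\mid b,a;\theta)=\sum_{s,s'}\eta(o\mid s')\theta(s'\mid s,a)b(s)$ and $\tau(b,a,o;\theta)(s')=\sum_s\eta(o\mid s')\theta(s'\mid s,a)b(s)/P(o\mid b,a;\theta)$. The belief $h_t(\cdot;\theta)$ is given by $h_1(s;\theta)\propto\eta(o_1\mid s)h(s;\theta)$ and $h_{t+1}(\cdot;\theta)=\tau(h_t(\cdot;\theta),a_t,o_{t+1};\theta)$. Let $\nu_\theta^{o_{1:t},a_{1:t}}(o)=P(o\mid h_t(\cdot;\theta),a_t;\theta)$ be the conditional probability under $\theta$ that the next observation is $o$; a history $o_{1:t},a_{1:t}$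 is possible under $\theta$ if $o_{1:t}$ has positive probability under $\theta$ when these actions are played. The posterior is $f_1(\theta)\propto\sum_s\eta(o_1\mid s)h(s;\theta)f(\theta)$, $f_{t+1}(\theta)\propto\nu_\theta^{o_{1:t},a_{1:t}}(o_{t+1})f_t(\theta)$. For a stationary policy $\pi:\Delta_{\mathcal S}\to\mathcal A$ let $J_\pi(h;\theta)=\limsup_{T}\frac1T\sum_{t\le T}\mathbb E[C(s_t,\pi(h_t(\cdot;\theta)))]$ when $s_1\sim h$, and let $J(\theta)=\inf_\pi J_\pi(h(\cdot;\theta);\theta)$. **Assumptions.** 1. (Bellman equation, span at most $H$.) For every $\theta\in\Theta$ there are $j_\theta\in\mathbb R$ and $v(\cdot;\theta):\Delta_{\mathcal S}\to[0,H]$ with $j_\theta+v(b;\theta)=\min_{a}\{\sum_sC(s,a)b(s)+\sum_oP(o\mid b,a;\theta)\,v(\tau(b,a,o;\theta);\theta)\}$ for all $b\in\Delta_{\mathcal S}$; $\pi^*(b;\theta)$ denotes a minimizing action. 2. (KL-separation.) There is $\epsilon>0$ such that for all $\theta\ne\gamma$ in $\Theta$ and every history $o_{1:t},a_{1:t}$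 possible under both, the Kullback–Leibler divergence of $\nu_\theta^{o_{1:t},a_{1:t}}$ from $\nu_\gamma^{o_{1:t},a_{1:t}}$, $\sum_o\nu_\theta(o)\log(\nu_\theta(o)/\nu_\gamma(o))$, is at least $\epsilon$. 3. (Bounded log-likelihood ratios.) There is $d$ such that for all $\theta,\gamma\in\Theta$, every history possible under both and every $o$: if $\nu_\gamma(o)>0$, then $\nu_\theta(o)\le e^{d}\nu_\gamma(o)$; if $\nu_\gamma(o)=0$, then $\nu_\theta(o)=0$ or $\nu_\theta(o)\ge e^{-d}$. **Algorithm** (PSRL-POMDP with $\mathrm{SCHED}(t_k,T_{k-1})=2t_k$ and $\tilde m_t(s,a)=t$). Episode $1$ starts at $t_1=1$; episode $k$ lasts while $t\le 2t_k$ and $\tilde m_t\le2\tilde m_{t_k}$, and then the next one starts. At the start of episode $k$ a parameter $\theta_k\sim f_{t_k}$ is sampled, and throughout the episode $a_t=\pi^*(h_t(\cdot;\theta_k);\theta_k)$ is played. **Claim.** Let $R_T=\mathbb E\big[\sum_{t=1}^T(C(s_t,a_t)-J(\theta_*))\,\big|\,\theta_*\big]$ be the expected regret when the true parameter is $\theta_*$.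 There is a constant $K$, independent of $T$ and $\theta_*$, such that for every $\theta_*\in\Theta$ with $f(\theta_*)>0$ and all $T\ge1$, $$|R_T|\le H\log_2T+K ;$$ in particular $R_T=O(\log T)$. -/

import Mathlib

open Filter Topology

namespace PsrlPomdp

noncomputable section

/-! Conventions.  `S`, `A`, `O` are the finite sets of states, actions and observations.
The observation kernel is `η s o = η(o | s)`, a transition kernel is `p s a s' = p(s' | s, a)`,
and `Δ_X` is `stdSimplex ℝ X`.  Time `t = 1, 2, ...` is the index `t - 1` here, so the
history before the action at index `t` is `o : Fin (t + 1) → O` with `a : Fin t → A`. -/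

section Filtering

variable {S A O : Type*} [Fintype S]

/-- `P(o | b, a; p)`: probability that the next observation is `o` when the current belief is `b`
and the action is `a`. -/
def obsProb (η : S → O → ℝ) (p : S → A → S → ℝ) (b : S → ℝ) (a : A) (o : O) : ℝ :=
  ∑ s', ∑ s, η s' o * p s a s' * b s

/-- The belief update `τ(b, a, o; p)` (the zero vector if `o` has probability zero). -/
def beliefUpdate (η : S → O → ℝ) (p : S → A → S → ℝ) (b : S → ℝ) (a : A) (o : O) : S → ℝ :=
  fun s' => (∑ s, η s' o * p s a s' * b s) / obsProb η p b a o

/-- Probability of the first observation when the initial state has law `h`. -/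
def initObsProb (η : S → O → ℝ) (h : S → ℝ) (o : O) : ℝ :=
  ∑ s, η s o * h s

/-- The belief on the state after the first observation. -/
def initBelief (η : S → O → ℝ) (h : S → ℝ) (o : O) : S → ℝ :=
  fun s => η s o * h s / initObsProb η h o

/-- The belief on the current state given the history, under the transition kernel `p` and the
initial law `h`. -/
def belief (η : S → O → ℝ) (p : S → A → S → ℝ) (h : S → ℝ) :
    (t : ℕ) → (Fin (t + 1) → O) → (Fin t → A) → S → ℝ
  | 0, o, _ => initBelief η h (o 0)
  | t + 1, o, a =>
      beliefUpdate η p (belief η p h t (Fin.init o) (Fin.init a)) (a (Fin.last t))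
        (o (Fin.last (t + 1)))

/-- `ν^{o_{1:t}, a_{1:t}}(o')`: conditional probability, under kernel `p` and initial law `h`, that
the next observation is `o'` given the history `o, a` and the last action `a'`. -/
def predictive (η : S → O → ℝ) (p : S → A → S → ℝ) (h : S → ℝ) (t : ℕ)
    (o : Fin (t + 1) → O) (a : Fin t → A) (a' : A) (o' : O) : ℝ :=
  obsProb η p (belief η p h t o a) a' o'

/-- Probability of the observations `o` when the actions are `a`: the probability of the first
observation times the product of the predictive probabilities. -/
def likelihood (η : S → O → ℝ) (p : S → A → S → ℝ) (h : S → ℝ) :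
    (t : ℕ) → (Fin (t + 1) → O) → (Fin t → A) → ℝ
  | 0, o, _ => initObsProb η h (o 0)
  | t + 1, o, a =>
      likelihood η p h t (Fin.init o) (Fin.init a) *
        predictive η p h t (Fin.init o) (Fin.init a) (a (Fin.last t)) (o (Fin.last (t + 1)))

/-- The posterior `f_t` on the finite parameter set `Θ` with prior `f`, for the transition kernels
`P θ` and initial laws `h θ`. -/
def posterior {Θ : Type*} [Fintype Θ] (η : S → O → ℝ) (P : Θ → S → A → S → ℝ) (h : Θ → S → ℝ)
    (f : Θ → ℝ) : (t : ℕ) → (Fin (t + 1) → O) → (Fin t → A) → Θ → ℝ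
  | 0, o, _ => fun θ =>
      initObsProb η (h θ) (o 0) * f θ / ∑ γ, initObsProb η (h γ) (o 0) * f γ
  | t + 1, o, a => fun θ =>
      predictive η (P θ) (h θ) t (Fin.init o) (Fin.init a) (a (Fin.last t))
          (o (Fin.last (t + 1))) * posterior η P h f t (Fin.init o) (Fin.init a) θ /
        ∑ γ, predictive η (P γ) (h γ) t (Fin.init o) (Fin.init a) (a (Fin.last t))
          (o (Fin.last (t + 1))) * posterior η P h f t (Fin.init o) (Fin.init a) γ

end Filtering

section Interaction

variable {S A O M : Type*}

/-- An agent with auxiliary randomness in `M`: at index `t` it draws the pair `(m_t, a_t)` of an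
auxiliary variable and an action with probability `agent t o m a m_t a_t`, where `o` are the
observations up to index `t` and `m`, `a` its own draws before index `t`. -/
abbrev Agent (A O M : Type*) : Type _ :=
  (t : ℕ) → (Fin (t + 1) → O) → (Fin t → M) → (Fin t → A) → M → A → ℝ

/-- Law of the state at index `t` given the trajectory of `(state, observation, auxiliary
variable, action)` before index `t`. -/
def stateProb (p : S → A → S → ℝ) (h : S → ℝ) :
    (t : ℕ) → (Fin t → S × O × M × A) → S → ℝ
  | 0, _ => h
  | t + 1, w => p (w (Fin.last t)).1 (w (Fin.last t)).2.2.2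

/-- Law of the quadruple `(s_t, o_t, m_t, a_t)` at index `t` given the trajectory before:
the state moves, the observation is emitted, the agent acts. -/
def stepProb (η : S → O → ℝ) (p : S → A → S → ℝ) (h : S → ℝ) (agent : Agent A O M)
    (t : ℕ) (w : Fin t → S × O × M × A) (z : S × O × M × A) : ℝ :=
  stateProb p h t w z.1 * η z.1 z.2.1 *
    agent t (Fin.snoc (α := fun _ => O) (fun i => (w i).2.1) z.2.1) (fun i => (w i).2.2.1)
      (fun i => (w i).2.2.2) z.2.2.1 z.2.2.2

/-- Probability of a trajectory of length `T`. -/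
def trajProb (η : S → O → ℝ) (p : S → A → S → ℝ) (h : S → ℝ) (agent : Agent A O M) :
    (T : ℕ) → (Fin T → S × O × M × A) → ℝ
  | 0, _ => 1
  | T + 1, w => trajProb η p h agent T (Fin.init w) *
      stepProb η p h agent T (Fin.init w) (w (Fin.last T))

/-- Expectation of a function of the trajectory of length `T`. -/
def expect [Fintype S] [Fintype A] [Fintype O] [Fintype M]
    (η : S → O → ℝ) (p : S → A → S → ℝ) (h : S → ℝ) (agent : Agent A O M) (T : ℕ)
    (X : (Fin T → S × O × M × A) → ℝ) : ℝ :=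
  ∑ w : Fin T → S × O × M × A, trajProb η p h agent T w * X w

end Interaction

section OptimalControl

variable {S A O : Type*} [Fintype S] [Fintype A] [DecidableEq A] [Fintype O]

/-- The agent that follows the deterministic stationary policy `π` on the belief for `p`. -/
def stationaryAgent (η : S → O → ℝ) (p : S → A → S → ℝ) (h : S → ℝ) (π : (S → ℝ) → A) :
    Agent A O Unit :=
  fun t o _ a _ a' => if a' = π (belief η p h t o a) then 1 else 0

/-- Long-term average cost `J_π(h; p)` of a deterministic stationary policy. -/
def avgCost (η : S → O → ℝ) (C : S → A → ℝ) (p : S → A → S → ℝ) (h : S → ℝ)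
    (π : (S → ℝ) → A) : ℝ :=
  limsup (fun T : ℕ => (1 / (T : ℝ)) *
    expect η p h (stationaryAgent η p h π) T (fun w => ∑ t, C (w t).1 (w t).2.2.2)) atTop

/-- Optimal long-term average cost `J(h; p) = inf_π J_π(h; p)`. -/
def optCost (η : S → O → ℝ) (C : S → A → ℝ) (p : S → A → S → ℝ) (h : S → ℝ) : ℝ :=
  ⨅ π : (S → ℝ) → A, avgCost η C p h π

/-- The bracket `c(b, a) + ∑_o P(o | b, a; p) v(τ(b, a, o; p))` of the Bellman equation. -/
def bellmanQ (η : S → O → ℝ) (C : S → A → ℝ) (p : S → A → S → ℝ) (v : (S → ℝ) → ℝ)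
    (b : S → ℝ) (a : A) : ℝ :=
  ∑ s, C s a * b s + ∑ o, obsProb η p b a o * v (beliefUpdate η p b a o)

/-- `J` and `v` solve the average-cost Bellman optimality equation on the belief simplex, with the
relative value function normalized so that its values lie in `[0, H]` (span at most `H`).
Only the values of `v` on the simplex matter. -/
structure IsBellmanSolution (η : S → O → ℝ) (C : S → A → ℝ) (p : S → A → S → ℝ) (H J : ℝ)
    (v : (S → ℝ) → ℝ) : Prop where
  bellman : ∀ b ∈ stdSimplex ℝ S, IsLeast (Set.range (bellmanQ η C p v b)) (J + v b)
  nonneg : ∀ b ∈ stdSimplex ℝ S, 0 ≤ v b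
  le_span : ∀ b ∈ stdSimplex ℝ S, v b ≤ H

/-- `π` selects at every belief a minimizer in the Bellman equation. -/
def IsGreedy (η : S → O → ℝ) (C : S → A → ℝ) (p : S → A → S → ℝ) (v : (S → ℝ) → ℝ)
    (π : (S → ℝ) → A) : Prop :=
  ∀ b ∈ stdSimplex ℝ S, ∀ a, bellmanQ η C p v b (π b) ≤ bellmanQ η C p v b a

end OptimalControl

section Separation

variable {S A O Θ : Type*} [Fintype S] [Fintype O]

open Classical in
/-- Kullback-Leibler divergence of two probability vectors on a finite set. -/
def kl (μ ν : O → ℝ) : EReal :=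
  if ∀ o, ν o = 0 → μ o = 0 then ((∑ o, μ o * Real.log (μ o / ν o) : ℝ) : EReal) else ⊤

/-- KL-separation: there is `ε > 0` such that, for all `θ ≠ γ` and all histories that are possible
under both, the predictive distributions of the next observation have divergence at least `ε`. -/
def KLSeparated (η : S → O → ℝ) (P : Θ → S → A → S → ℝ) (h : Θ → S → ℝ) : Prop :=
  ∃ ε : ℝ, 0 < ε ∧ ∀ θ γ : Θ, θ ≠ γ →
    ∀ (t : ℕ) (o : Fin (t + 1) → O) (a : Fin t → A) (a' : A),
      0 < likelihood η (P θ) (h θ) t o a → 0 < likelihood η (P γ) (h γ) t o a →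
        (ε : EReal) ≤ kl (predictive η (P θ) (h θ) t o a a') (predictive η (P γ) (h γ) t o a a')

/-- Bounded log-likelihood ratios: along all histories that are possible under both `θ` and `γ`,
the log-likelihood ratio of the next observation is at most `d` where the denominator is positive,
and an observation that is possible under `θ` but not under `γ` has `θ`-probability at least
`exp (-d)`. -/
def BoundedLikelihoodRatios (η : S → O → ℝ) (P : Θ → S → A → S → ℝ) (h : Θ → S → ℝ) : Prop :=
  ∃ d : ℝ, ∀ θ γ : Θ,
    ∀ (t : ℕ) (o : Fin (t + 1) → O) (a : Fin t → A) (a' : A),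
      0 < likelihood η (P θ) (h θ) t o a → 0 < likelihood η (P γ) (h γ) t o a →
        ∀ o' : O,
          (predictive η (P γ) (h γ) t o a a' o' ≠ 0 →
            predictive η (P θ) (h θ) t o a a' o' ≤
              Real.exp d * predictive η (P γ) (h γ) t o a a' o') ∧
          (predictive η (P γ) (h γ) t o a a' o' = 0 →
            predictive η (P θ) (h θ) t o a a' o' = 0 ∨
              Real.exp (-d) ≤ predictive η (P θ) (h θ) t o a a' o')

end Separation

section Algorithm

open Classical in
/-- The pair `(t_k, T_{k-1})` of the episode `k` to which index `i` (time `i + 1`) belongs, for a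
schedule `sched t_k T_{k-1}` and a deterministic pseudo-count `m t s a`.  The first episode has
`t_1 = 1`, `T_0 = 1`; an episode goes on while `t ≤ sched t_k T_{k-1}` and
`m t s a ≤ 2 * m t_k s a` for all `(s, a)`. -/
def episode {S A : Type*} (sched : ℕ → ℕ → ℕ) (m : ℕ → S → A → ℕ) : ℕ → ℕ × ℕ
  | 0 => (1, 1)
  | i + 1 =>
      if i + 2 ≤ sched (episode sched m i).1 (episode sched m i).2 ∧
          ∀ s a, m (i + 2) s a ≤ 2 * m (episode sched m i).1 s a then
        episode sched m i
      else (i + 2, i + 2 - (episode sched m i).1)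

variable {S A O Θ : Type*} [Fintype S] [DecidableEq A] [Fintype Θ] [DecidableEq Θ]

/-- Law of the parameter in use at index `t`: drawn from the posterior at the start of an episode,
kept otherwise. -/
def paramProb (η : S → O → ℝ) (P : Θ → S → A → S → ℝ) (h : Θ → S → ℝ) (f : Θ → ℝ)
    (sched : ℕ → ℕ → ℕ) (m : ℕ → S → A → ℕ) :
    (t : ℕ) → (Fin (t + 1) → O) → (Fin t → Θ) → (Fin t → A) → Θ → ℝ
  | 0, o, _, a => posterior η P h f 0 o a
  | t + 1, o, ϑ, a => fun θ =>
      if (episode sched m (t + 1)).1 = t + 2 then posterior η P h f (t + 1) o a θ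
      else if θ = ϑ (Fin.last t) then 1 else 0

/-- PSRL-POMDP with priors `f`, `h`: with the parameter `θ` in use, it plays the action
`π θ (h_t(·; θ))`.  The auxiliary variable of the agent is the parameter in use. -/
def psrlAgent (η : S → O → ℝ) (P : Θ → S → A → S → ℝ) (h : Θ → S → ℝ) (f : Θ → ℝ)
    (π : Θ → (S → ℝ) → A) (sched : ℕ → ℕ → ℕ) (m : ℕ → S → A → ℕ) : Agent A O Θ :=
  fun t o ϑ a θ a' => paramProb η P h f sched m t o ϑ a θ *
    if a' = π θ (belief η (P θ) (h θ) t o a) then 1 else 0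

/-- Expected regret `R_T = E[∑_{t ≤ T} (C(s_t, a_t) - J(θ⋆)) | θ⋆]` of PSRL-POMDP. -/
def regret [Fintype A] [Fintype O] (η : S → O → ℝ) (C : S → A → ℝ) (P : Θ → S → A → S → ℝ)
    (h : Θ → S → ℝ) (f : Θ → ℝ) (π : Θ → (S → ℝ) → A) (sched : ℕ → ℕ → ℕ)
    (m : ℕ → S → A → ℕ) (θ : Θ) (T : ℕ) : ℝ :=
  expect η (P θ) (h θ) (psrlAgent η P h f π sched m) T
    (fun w => ∑ t, (C (w t).1 (w t).2.2.2 - optCost η C (P θ) (h θ)))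

end Algorithm

end

end PsrlPomdp

namespace PsrlPomdp

noncomputable section

section Extend

variable {α β : Type*}

/-- Append one entry to a finite sequence. -/
abbrev extend {n : ℕ} (y : Fin n → α) (z : α) : Fin (n + 1) → α :=
  Fin.snoc (α := fun _ => α) y z

lemma map_extend (g : α → β) {n : ℕ} (y : Fin n → α) (z : α) :
    (fun i => g (extend y z i)) = extend (fun i => g (y i)) (g z) :=
  Fin.comp_snoc g y z

lemma init_extend {n : ℕ} (y : Fin n → α) (z : α) : Fin.init (extend y z) = y :=
  Fin.init_snoc (α := fun _ => α) z y

lemma extend_last {n : ℕ} (y : Fin n → α) (z : α) : extend y z (Fin.last n) = z :=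
  Fin.snoc_last (α := fun _ => α) z y

lemma sum_extend [Fintype α] {n : ℕ} (G : (Fin (n + 1) → α) → ℝ) :
    ∑ x, G x = ∑ y : Fin n → α, ∑ z, G (extend y z) := by
  rw [← (Fin.snocEquiv fun _ : Fin (n + 1) => α).sum_comp, Fintype.sum_prod_type_right]
  rfl

end Extend

section Filter

variable {S A O : Type*} [Fintype S] [Fintype O]
  {η : S → O → ℝ} {p : S → A → S → ℝ} {h : S → ℝ}

section Update

variable (hη : ∀ s, η s ∈ stdSimplex ℝ O) (hp : ∀ s a, p s a ∈ stdSimplex ℝ S)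
include hη hp

lemma obsProb_nonneg {b : S → ℝ} (hb : ∀ s, 0 ≤ b s) (a : A) (o : O) :
    0 ≤ obsProb η p b a o :=
  Finset.sum_nonneg fun s' _ => Finset.sum_nonneg fun s _ =>
    mul_nonneg (mul_nonneg ((hη s').1 o) ((hp s a).1 s')) (hb s)

lemma sum_obsProb (b : S → ℝ) (a : A) : ∑ o, obsProb η p b a o = ∑ s, b s := by
  unfold obsProb
  rw [Finset.sum_comm]
  calc ∑ s', ∑ o, ∑ s, η s' o * p s a s' * b s
      = ∑ s', ∑ s, p s a s' * b s := by
        refine Finset.sum_congr rfl fun s' _ => ?_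
        rw [Finset.sum_comm]
        refine Finset.sum_congr rfl fun s _ => ?_
        simp_rw [mul_assoc, ← Finset.sum_mul, (hη s').2, one_mul]
    _ = ∑ s, b s := by
        rw [Finset.sum_comm]
        refine Finset.sum_congr rfl fun s _ => ?_
        rw [← Finset.sum_mul, (hp s a).2, one_mul]

lemma beliefUpdate_nonneg {b : S → ℝ} (hb : ∀ s, 0 ≤ b s) (a : A) (o : O) (s' : S) :
    0 ≤ beliefUpdate η p b a o s' :=
  div_nonneg (Finset.sum_nonneg fun s _ =>
    mul_nonneg (mul_nonneg ((hη s').1 o) ((hp s a).1 s')) (hb s)) (obsProb_nonneg hη hp hb a o)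

lemma obsProb_mul_beliefUpdate {b : S → ℝ} (hb : ∀ s, 0 ≤ b s) (a : A) (o : O) (s' : S) :
    obsProb η p b a o * beliefUpdate η p b a o s' = ∑ s, η s' o * p s a s' * b s := by
  have hn : ∀ s', 0 ≤ ∑ s, η s' o * p s a s' * b s := fun s' => Finset.sum_nonneg fun s _ =>
    mul_nonneg (mul_nonneg ((hη s').1 o) ((hp s a).1 s')) (hb s)
  by_cases h0 : obsProb η p b a o = 0
  · rw [h0, zero_mul]
    exact ((Finset.sum_eq_zero_iff_of_nonneg fun s' _ => hn s').1 h0 s' (Finset.mem_univ _)).symm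
  · exact mul_div_cancel₀ _ h0

lemma beliefUpdate_mem {b : S → ℝ} (hb : ∀ s, 0 ≤ b s) {a : A} {o : O}
    (h0 : obsProb η p b a o ≠ 0) : beliefUpdate η p b a o ∈ stdSimplex ℝ S := by
  refine ⟨beliefUpdate_nonneg hη hp hb a o, ?_⟩
  unfold beliefUpdate
  rw [← Finset.sum_div]
  exact div_self h0

end Update

section Initial

variable (hη : ∀ s, η s ∈ stdSimplex ℝ O) (hh : h ∈ stdSimplex ℝ S)
include hη hh

lemma initObsProb_nonneg (o : O) : 0 ≤ initObsProb η h o :=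
  Finset.sum_nonneg fun s _ => mul_nonneg ((hη s).1 o) (hh.1 s)

lemma sum_initObsProb : ∑ o, initObsProb η h o = 1 := by
  unfold initObsProb
  rw [Finset.sum_comm]
  simp_rw [← Finset.sum_mul, (hη _).2, one_mul, hh.2]

lemma initBelief_nonneg (o : O) (s : S) : 0 ≤ initBelief η h o s :=
  div_nonneg (mul_nonneg ((hη s).1 o) (hh.1 s)) (initObsProb_nonneg hη hh o)

lemma initObsProb_mul_initBelief (o : O) (s : S) :
    initObsProb η h o * initBelief η h o s = η s o * h s := by
  by_cases h0 : initObsProb η h o = 0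
  · rw [h0, zero_mul]
    exact ((Finset.sum_eq_zero_iff_of_nonneg fun s _ =>
      mul_nonneg ((hη s).1 o) (hh.1 s)).1 h0 s (Finset.mem_univ _)).symm
  · exact mul_div_cancel₀ _ h0

lemma likelihood_mul_belief_zero (o : Fin 1 → O) (a : Fin 0 → A) (s : S) :
    likelihood η p h 0 o a * belief η p h 0 o a s = η s (o 0) * h s :=
  initObsProb_mul_initBelief hη hh (o 0) s

end Initial

variable (hη : ∀ s, η s ∈ stdSimplex ℝ O) (hp : ∀ s a, p s a ∈ stdSimplex ℝ S)
  (hh : h ∈ stdSimplex ℝ S)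
include hη hp hh

lemma belief_nonneg : ∀ (t : ℕ) (o : Fin (t + 1) → O) (a : Fin t → A) (s : S),
    0 ≤ belief η p h t o a s
  | 0, o, _, s => initBelief_nonneg hη hh (o 0) s
  | t + 1, _, _, s => beliefUpdate_nonneg hη hp (belief_nonneg t _ _) _ _ s

lemma predictive_nonneg (t : ℕ) (o : Fin (t + 1) → O) (a : Fin t → A) (a' : A) (o' : O) :
    0 ≤ predictive η p h t o a a' o' :=
  obsProb_nonneg hη hp (belief_nonneg hη hp hh t o a) a' o'

lemma likelihood_nonneg : ∀ (t : ℕ) (o : Fin (t + 1) → O) (a : Fin t → A),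
    0 ≤ likelihood η p h t o a
  | 0, o, _ => initObsProb_nonneg hη hh (o 0)
  | t + 1, _, _ => mul_nonneg (likelihood_nonneg t _ _) (predictive_nonneg hη hp hh t _ _ _ _)

lemma belief_mem : ∀ (t : ℕ) (o : Fin (t + 1) → O) (a : Fin t → A),
    likelihood η p h t o a ≠ 0 → belief η p h t o a ∈ stdSimplex ℝ S
  | 0, o, _, h0 => by
      refine ⟨initBelief_nonneg hη hh (o 0), ?_⟩
      change ∑ s, η s (o 0) * h s / initObsProb η h (o 0) = 1
      rw [← Finset.sum_div]
      exact div_self h0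
  | t + 1, _, _, h0 =>
      beliefUpdate_mem hη hp (belief_nonneg hη hp hh t _ _) (right_ne_zero_of_mul h0)

lemma sum_predictive {t : ℕ} {o : Fin (t + 1) → O} {a : Fin t → A}
    (h0 : likelihood η p h t o a ≠ 0) (a' : A) : ∑ o', predictive η p h t o a a' o' = 1 := by
  unfold predictive
  rw [sum_obsProb hη hp, (belief_mem hη hp hh t o a h0).2]

lemma likelihood_mul_belief_succ (t : ℕ) (o : Fin (t + 2) → O) (a : Fin (t + 1) → A) (s' : S) :
    likelihood η p h (t + 1) o a * belief η p h (t + 1) o a s' =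
      ∑ s, likelihood η p h t (Fin.init o) (Fin.init a) *
        belief η p h t (Fin.init o) (Fin.init a) s *
          (p s (a (Fin.last t)) s' * η s' (o (Fin.last (t + 1)))) := by
  change likelihood η p h t (Fin.init o) (Fin.init a) * obsProb η p _ _ _ *
    beliefUpdate η p _ _ _ s' = _
  rw [mul_assoc, obsProb_mul_beliefUpdate hη hp (belief_nonneg hη hp hh t _ _), Finset.mul_sum]
  exact Finset.sum_congr rfl fun s _ => by ring

end Filter

section Observed

variable {S A O M : Type*} [Fintype S]

/-- Product of the probabilities of the agent's draws along an observed history. -/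
def agentProd (agent : Agent A O M) : (n : ℕ) → (Fin n → O × M × A) → ℝ
  | 0, _ => 1
  | n + 1, x => agentProd agent n (Fin.init x) *
      agent n (fun i => (x i).1) (fun i => (Fin.init x i).2.1) (fun i => (Fin.init x i).2.2)
        (x (Fin.last n)).2.1 (x (Fin.last n)).2.2

/-- The agent's law of its draw given the observed history `y` and the new observation `o`. -/
def draw (agent : Agent A O M) {T : ℕ} (y : Fin T → O × M × A) (o : O) : M → A → ℝ :=
  agent T (extend (fun i => (y i).1) o) (fun i => (y i).2.1) (fun i => (y i).2.2)

/-- Likelihood of the observed history `y` followed by the observation `o`. -/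
def likelihoodBefore (η : S → O → ℝ) (p : S → A → S → ℝ) (h : S → ℝ) {T : ℕ}
    (y : Fin T → O × M × A) (o : O) : ℝ :=
  likelihood η p h T (extend (fun i => (y i).1) o) (fun i => (y i).2.2)

/-- Belief after the observed history `y` followed by the observation `o`. -/
def beliefBefore (η : S → O → ℝ) (p : S → A → S → ℝ) (h : S → ℝ) {T : ℕ}
    (y : Fin T → O × M × A) (o : O) : S → ℝ :=
  belief η p h T (extend (fun i => (y i).1) o) (fun i => (y i).2.2)

/-- Belief used for the last action of the observed history `x`. -/
def beliefLast (η : S → O → ℝ) (p : S → A → S → ℝ) (h : S → ℝ) {T : ℕ}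
    (x : Fin (T + 1) → O × M × A) : S → ℝ :=
  belief η p h T (fun i => (x i).1) (fun i => (Fin.init x i).2.2)

/-- Last action of an observed history. -/
def lastAction {T : ℕ} (x : Fin (T + 1) → O × M × A) : A := (x (Fin.last T)).2.2

/-- Last auxiliary variable of an observed history. -/
def lastAux {T : ℕ} (x : Fin (T + 1) → O × M × A) : M := (x (Fin.last T)).2.1

variable {η : S → O → ℝ} {p : S → A → S → ℝ} {h : S → ℝ} {agent : Agent A O M}

lemma agentProd_extend {T : ℕ} (y : Fin T → O × M × A) (o : O) (m : M) (a : A) :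
    agentProd agent (T + 1) (extend y (o, m, a)) = agentProd agent T y * draw agent y o m a := by
  simp only [agentProd, draw, init_extend, extend_last]
  rw [map_extend (fun z : O × M × A => z.1)]

lemma beliefLast_extend {T : ℕ} (y : Fin T → O × M × A) (o : O) (m : M) (a : A) :
    beliefLast η p h (extend y (o, m, a)) = beliefBefore η p h y o := by
  simp only [beliefLast, beliefBefore, init_extend]
  rw [map_extend (fun z : O × M × A => z.1)]

lemma lastAction_extend {T : ℕ} (y : Fin T → O × M × A) (o : O) (m : M) (a : A) :
    lastAction (extend y (o, m, a)) = a := by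
  simp only [lastAction, extend_last]

lemma lastAux_extend {T : ℕ} (y : Fin T → O × M × A) (o : O) (m : M) (a : A) :
    lastAux (extend y (o, m, a)) = m := by
  simp only [lastAux, extend_last]

lemma likelihoodBefore_succ {T : ℕ} (x : Fin (T + 1) → O × M × A) (o : O) :
    likelihoodBefore η p h x o =
      likelihood η p h T (fun i => (x i).1) (fun i => (Fin.init x i).2.2) *
        obsProb η p (beliefLast η p h x) (lastAction x) o := by
  simp only [likelihoodBefore, likelihood, init_extend, extend_last]
  rfl

lemma likelihoodBefore_extend {T : ℕ} (y : Fin T → O × M × A) (o : O) (m : M) (a : A) (o' : O) :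
    likelihoodBefore η p h (extend y (o, m, a)) o' =
      likelihoodBefore η p h y o * obsProb η p (beliefBefore η p h y o) a o' := by
  rw [likelihoodBefore_succ, beliefLast_extend, lastAction_extend]
  simp only [init_extend]
  rw [map_extend (fun z : O × M × A => z.1)]
  rfl

lemma likelihoodBefore_mul_belief_extend [Fintype O]
    (hη : ∀ s, η s ∈ stdSimplex ℝ O) (hp : ∀ s a, p s a ∈ stdSimplex ℝ S)
    (hh : h ∈ stdSimplex ℝ S) {T : ℕ} (y : Fin T → O × M × A) (o : O) (m : M) (a : A)
    (o' : O) (s' : S) :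
    likelihoodBefore η p h (extend y (o, m, a)) o' *
        beliefBefore η p h (extend y (o, m, a)) o' s' =
      ∑ s, likelihoodBefore η p h y o * beliefBefore η p h y o s * (p s a s' * η s' o') := by
  unfold likelihoodBefore beliefBefore
  rw [likelihood_mul_belief_succ hη hp hh]
  simp only [init_extend, extend_last]
  rw [map_extend (fun z : O × M × A => z.1), map_extend (fun z : O × M × A => z.2.2)]
  simp only [init_extend]

variable [Fintype A] [Fintype O] [Fintype M]

/-- Sum of a weight against the law of the agent's draws, just before the draw at index `T`. -/
def preSum (agent : Agent A O M) (T : ℕ) (G : (Fin T → O × M × A) → O → ℝ) : ℝ :=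
  ∑ y, agentProd agent T y * ∑ o, G y o

/-- Expectation of a function of the observed history up to and including the observation at
index `T`, before the draw at that index. -/
def preExpect (η : S → O → ℝ) (p : S → A → S → ℝ) (h : S → ℝ) (agent : Agent A O M) (T : ℕ)
    (G : (Fin T → O × M × A) → O → ℝ) : ℝ :=
  preSum agent T fun y o => likelihoodBefore η p h y o * G y o

/-- Expectation of a function of the observed history up to and including the draw at
index `T`. -/
def obsExpect (η : S → O → ℝ) (p : S → A → S → ℝ) (h : S → ℝ) (agent : Agent A O M) (T : ℕ)
    (G : (Fin (T + 1) → O × M × A) → ℝ) : ℝ :=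
  preExpect η p h agent T fun y o => ∑ m, ∑ a, draw agent y o m a * G (extend y (o, m, a))

lemma preSum_succ (T : ℕ) (G : (Fin (T + 1) → O × M × A) → O → ℝ) :
    preSum agent (T + 1) G = preSum agent T fun y o =>
      ∑ m, ∑ a, draw agent y o m a * ∑ o', G (extend y (o, m, a)) o' := by
  unfold preSum
  rw [sum_extend]
  refine Finset.sum_congr rfl fun y _ => ?_
  simp_rw [Fintype.sum_prod_type, agentProd_extend, mul_assoc, Finset.mul_sum]

lemma preExpect_succ (T : ℕ) (G : (Fin (T + 1) → O × M × A) → O → ℝ) :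
    preExpect η p h agent (T + 1) G = obsExpect η p h agent T fun x =>
      ∑ o, obsProb η p (beliefLast η p h x) (lastAction x) o * G x o := by
  unfold obsExpect preExpect
  rw [preSum_succ]
  congr! 3 with y o
  simp_rw [Finset.mul_sum]
  refine Finset.sum_congr rfl fun m _ => Finset.sum_congr rfl fun a _ =>
    Finset.sum_congr rfl fun o' _ => ?_
  rw [likelihoodBefore_extend, beliefLast_extend, lastAction_extend]
  ring

/-- Law of the current state and the observed history: the conditional law of the state is the
belief. -/
theorem sum_trajProb_eq_preSum
    (hη : ∀ s, η s ∈ stdSimplex ℝ O) (hp : ∀ s a, p s a ∈ stdSimplex ℝ S)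
    (hh : h ∈ stdSimplex ℝ S) : ∀ (T : ℕ) (F : (Fin T → O × M × A) → O → S → ℝ),
    ∑ w : Fin T → S × O × M × A, trajProb η p h agent T w *
        ∑ s, ∑ o, stateProb p h T w s * η s o * F (fun i => (w i).2) o s =
      preSum agent T fun y o => ∑ s, likelihoodBefore η p h y o * beliefBefore η p h y o s * F y o s
  | 0, F => by
      simp only [preSum, trajProb, agentProd, stateProb, one_mul, Finset.univ_unique,
        Finset.sum_singleton]
      rw [Finset.sum_comm]
      refine Finset.sum_congr rfl fun o _ => Finset.sum_congr rfl fun s _ => ?_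
      unfold likelihoodBefore beliefBefore
      rw [likelihood_mul_belief_zero hη hh, show (extend _ o : Fin 1 → O) 0 = o from
        extend_last (n := 0) _ o, mul_comm (h s)]
      congr
      exact Subsingleton.elim _ _
  | T + 1, F => by
      have key := sum_trajProb_eq_preSum hη hp hh T fun y o s =>
        ∑ m, ∑ a, draw agent y o m a *
          ∑ s', ∑ o', p s a s' * η s' o' * F (extend y (o, m, a)) o' s'
      rw [preSum_succ]
      refine Eq.trans ?_ (key.trans ?_)
      · rw [sum_extend]
        refine Finset.sum_congr rfl fun w _ => ?_
        rw [Finset.mul_sum, Fintype.sum_prod_type]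
        refine Finset.sum_congr rfl fun s _ => ?_
        rw [Fintype.sum_prod_type, Finset.mul_sum]
        refine Finset.sum_congr rfl fun o _ => ?_
        rw [Fintype.sum_prod_type, Finset.mul_sum, Finset.mul_sum]
        refine Finset.sum_congr rfl fun m _ => ?_
        rw [Finset.mul_sum, Finset.mul_sum]
        refine Finset.sum_congr rfl fun a _ => ?_
        simp only [trajProb, stepProb, stateProb, init_extend, extend_last]
        rw [map_extend (fun z : S × O × M × A => z.2)]
        simp only [draw]
        ring
      · congr 1
        funext y o
        simp_rw [Finset.mul_sum]
        rw [Finset.sum_comm]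
        refine Finset.sum_congr rfl fun m _ => ?_
        rw [Finset.sum_comm]
        refine Finset.sum_congr rfl fun a _ => ?_
        simp_rw [likelihoodBefore_mul_belief_extend hη hp hh, Finset.sum_mul, Finset.mul_sum]
        rw [Finset.sum_comm]
        conv_lhs => enter [2, s']; rw [Finset.sum_comm]
        rw [Finset.sum_comm]
        refine Finset.sum_congr rfl fun o' _ => Finset.sum_congr rfl fun s' _ =>
          Finset.sum_congr rfl fun s _ => ?_
        ring

end Observed

section Observed

variable {S A O M : Type*} [Fintype S] [Fintype A] [Fintype O] [Fintype M]

/-- The agent draws from a probability distribution after every history that is possible under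
`p`, `h`. -/
structure IsProper (η : S → O → ℝ) (p : S → A → S → ℝ) (h : S → ℝ) (agent : Agent A O M) :
    Prop where
  nonneg : ∀ T o m a m' a', 0 ≤ agent T o m a m' a'
  sum_eq_one : ∀ T o m a, likelihood η p h T o a ≠ 0 → ∑ m', ∑ a', agent T o m a m' a' = 1

variable {η : S → O → ℝ} {p : S → A → S → ℝ} {h : S → ℝ} {agent : Agent A O M}

omit [Fintype O] in
lemma IsProper.sum_draw (hA : IsProper η p h agent) {T : ℕ} {y : Fin T → O × M × A} {o : O}
    (h0 : likelihoodBefore η p h y o ≠ 0) : ∑ m, ∑ a, draw agent y o m a = 1 :=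
  hA.sum_eq_one T _ _ _ h0

omit [Fintype O] in
lemma IsProper.agentProd_nonneg (hA : IsProper η p h agent) :
    ∀ (n : ℕ) (y : Fin n → O × M × A), 0 ≤ agentProd agent n y
  | 0, _ => zero_le_one
  | n + 1, _ => mul_nonneg (hA.agentProd_nonneg n _) (hA.nonneg _ _ _ _ _ _)

lemma IsProper.preSum_mono (hA : IsProper η p h agent) {T : ℕ}
    {G G' : (Fin T → O × M × A) → O → ℝ} (hG : ∀ y o, G y o ≤ G' y o) :
    preSum agent T G ≤ preSum agent T G' :=
  Finset.sum_le_sum fun y _ => mul_le_mul_of_nonneg_left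
    (Finset.sum_le_sum fun o _ => hG y o) (hA.agentProd_nonneg T y)

lemma preSum_const_mul (T : ℕ) (c : ℝ) (G : (Fin T → O × M × A) → O → ℝ) :
    preSum agent T (fun y o => c * G y o) = c * preSum agent T G := by
  simp only [preSum, ← Finset.mul_sum, mul_left_comm _ c]

lemma preExpect_congr {T : ℕ} {G G' : (Fin T → O × M × A) → O → ℝ}
    (hG : ∀ y o, likelihoodBefore η p h y o ≠ 0 → G y o = G' y o) :
    preExpect η p h agent T G = preExpect η p h agent T G' := by
  unfold preExpect
  congr 1
  funext y o
  by_cases h0 : likelihoodBefore η p h y o = 0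
  · rw [h0, zero_mul, zero_mul]
  · rw [hG y o h0]

lemma obsExpect_add (T : ℕ) (G G' : (Fin (T + 1) → O × M × A) → ℝ) :
    obsExpect η p h agent T (fun x => G x + G' x) =
      obsExpect η p h agent T G + obsExpect η p h agent T G' := by
  simp only [obsExpect, preExpect, preSum, mul_add, Finset.sum_add_distrib]

lemma obsExpect_const_mul (T : ℕ) (c : ℝ) (G : (Fin (T + 1) → O × M × A) → ℝ) :
    obsExpect η p h agent T (fun x => c * G x) = c * obsExpect η p h agent T G := by
  simp only [obsExpect, preExpect, preSum, ← Finset.mul_sum, mul_left_comm _ c]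

lemma obsExpect_sum {ι : Type*} (s : Finset ι) (T : ℕ) (G : ι → (Fin (T + 1) → O × M × A) → ℝ) :
    obsExpect η p h agent T (fun x => ∑ i ∈ s, G i x) =
      ∑ i ∈ s, obsExpect η p h agent T (G i) := by
  classical
  induction s using Finset.induction_on with
  | empty => simp [obsExpect, preExpect, preSum]
  | insert i s hi ih => simp only [Finset.sum_insert hi, obsExpect_add, ih]

/-- Likelihood of the observations of a history. -/
def likelihoodLast (η : S → O → ℝ) (p : S → A → S → ℝ) (h : S → ℝ) {T : ℕ}
    (x : Fin (T + 1) → O × M × A) : ℝ :=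
  likelihood η p h T (fun i => (x i).1) (fun i => (Fin.init x i).2.2)

omit [Fintype A] [Fintype O] [Fintype M] in
lemma likelihoodLast_extend {T : ℕ} (y : Fin T → O × M × A) (o : O) (m : M) (a : A) :
    likelihoodLast η p h (extend y (o, m, a)) = likelihoodBefore η p h y o := by
  simp only [likelihoodLast, likelihoodBefore, init_extend]
  rw [map_extend (fun z : O × M × A => z.1)]

lemma obsExpect_congr {T : ℕ} {G G' : (Fin (T + 1) → O × M × A) → ℝ}
    (hG : ∀ x, likelihoodLast η p h x ≠ 0 → G x = G' x) :
    obsExpect η p h agent T G = obsExpect η p h agent T G' := by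
  refine preExpect_congr fun y o h0 => Finset.sum_congr rfl fun m _ =>
    Finset.sum_congr rfl fun a _ => ?_
  rw [hG _ (by rwa [likelihoodLast_extend])]

/-- A function of the history before the draw has the same expectation before and after it. -/
lemma IsProper.obsExpect_eq_preExpect (hA : IsProper η p h agent) (T : ℕ)
    (G : (Fin T → O × M × A) → O → ℝ) :
    obsExpect η p h agent T (fun x => G (Fin.init x) (x (Fin.last T)).1) =
      preExpect η p h agent T G := by
  refine preExpect_congr fun y o h0 => ?_
  simp only [init_extend, extend_last, ← Finset.sum_mul, hA.sum_draw h0, one_mul]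

omit [Fintype A] [Fintype O] [Fintype M] in
lemma stateProb_mem (hp : ∀ s a, p s a ∈ stdSimplex ℝ S) (hh : h ∈ stdSimplex ℝ S) :
    ∀ (T : ℕ) (w : Fin T → S × O × M × A), stateProb p h T w ∈ stdSimplex ℝ S
  | 0, _ => hh
  | _ + 1, _ => hp _ _

section

variable (hη : ∀ s, η s ∈ stdSimplex ℝ O) (hp : ∀ s a, p s a ∈ stdSimplex ℝ S)
  (hh : h ∈ stdSimplex ℝ S)
include hη hp hh

lemma IsProper.obsExpect_mono (hA : IsProper η p h agent) {T : ℕ}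
    {G G' : (Fin (T + 1) → O × M × A) → ℝ}
    (hG : ∀ x, likelihoodLast η p h x ≠ 0 → G x ≤ G' x) :
    obsExpect η p h agent T G ≤ obsExpect η p h agent T G' := by
  refine hA.preSum_mono fun y o => ?_
  by_cases h0 : likelihoodBefore η p h y o = 0
  · rw [h0, zero_mul, zero_mul]
  · refine mul_le_mul_of_nonneg_left ?_ (likelihood_nonneg hη hp hh _ _ _)
    refine Finset.sum_le_sum fun m _ => Finset.sum_le_sum fun a _ =>
      mul_le_mul_of_nonneg_left (hG _ ?_) (hA.nonneg _ _ _ _ _ _)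
    rwa [likelihoodLast_extend]

omit [Fintype A] [Fintype M] in
lemma beliefLast_mem {T : ℕ} {x : Fin (T + 1) → O × M × A} (h0 : likelihoodLast η p h x ≠ 0) :
    beliefLast η p h x ∈ stdSimplex ℝ S :=
  belief_mem hη hp hh T _ _ h0

lemma IsProper.preExpect_one (hA : IsProper η p h agent) :
    ∀ T, preExpect η p h agent T (fun _ _ => 1) = 1
  | 0 => by
      simp only [preExpect, preSum, agentProd, one_mul, mul_one, Finset.univ_unique,
        Finset.sum_singleton]
      exact sum_initObsProb hη hh
  | T + 1 => by
      rw [preExpect_succ]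
      calc _ = obsExpect η p h agent T (fun _ => 1) := obsExpect_congr fun x h0 => by
              simp only [mul_one]
              rw [sum_obsProb hη hp, (beliefLast_mem hη hp hh h0).2]
        _ = 1 := (hA.obsExpect_eq_preExpect T fun _ _ => 1).trans (hA.preExpect_one T)

lemma IsProper.obsExpect_const (hA : IsProper η p h agent) (T : ℕ) (c : ℝ) :
    obsExpect η p h agent T (fun _ => c) = c := by
  have h1 := obsExpect_const_mul (η := η) (p := p) (h := h) (agent := agent) T c fun _ => 1
  simp only [mul_one] at h1
  rw [h1, (hA.obsExpect_eq_preExpect T fun _ _ => 1).trans (hA.preExpect_one hη hp hh T), mul_one]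

/-- The current state may be averaged over the belief. -/
theorem expect_last (T : ℕ) (F : (Fin (T + 1) → O × M × A) → S → ℝ) :
    expect η p h agent (T + 1) (fun w => F (fun i => (w i).2) (w (Fin.last T)).1) =
      obsExpect η p h agent T (fun x => ∑ s, beliefLast η p h x s * F x s) := by
  have key := sum_trajProb_eq_preSum (agent := agent) hη hp hh T fun y o s =>
    ∑ m, ∑ a, draw agent y o m a * F (extend y (o, m, a)) s
  refine Eq.trans ?_ (key.trans ?_)
  · unfold expect
    rw [sum_extend]
    refine Finset.sum_congr rfl fun w _ => ?_
    rw [Finset.mul_sum, Fintype.sum_prod_type]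
    refine Finset.sum_congr rfl fun s _ => ?_
    rw [Fintype.sum_prod_type, Finset.mul_sum]
    refine Finset.sum_congr rfl fun o _ => ?_
    rw [Fintype.sum_prod_type, Finset.mul_sum, Finset.mul_sum]
    refine Finset.sum_congr rfl fun m _ => ?_
    rw [Finset.mul_sum, Finset.mul_sum]
    refine Finset.sum_congr rfl fun a _ => ?_
    simp only [trajProb, stepProb, init_extend, extend_last]
    rw [map_extend (fun z : S × O × M × A => z.2)]
    simp only [draw]
    ring
  · unfold obsExpect preExpect
    congr 1
    funext y o
    simp_rw [beliefLast_extend, Finset.mul_sum]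
    rw [Finset.sum_comm]
    refine Finset.sum_congr rfl fun m _ => ?_
    rw [Finset.sum_comm]
    refine Finset.sum_congr rfl fun a _ => Finset.sum_congr rfl fun s _ => ?_
    ring

omit [Fintype A] [Fintype M] in
lemma likelihoodBefore_mul_beliefBefore_ne_zero :
    ∀ (T : ℕ) (w : Fin T → S × O × M × A) (s : S) (o : O),
      trajProb η p h agent T w ≠ 0 → stateProb p h T w s * η s o ≠ 0 →
        likelihoodBefore η p h (fun i => (w i).2) o * beliefBefore η p h (fun i => (w i).2) o s ≠ 0
  | 0, w, s, o, _, hs => by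
      unfold likelihoodBefore beliefBefore
      rw [likelihood_mul_belief_zero hη hh, show (extend _ o : Fin 1 → O) 0 = o from
        extend_last (n := 0) _ o, mul_comm]
      exact hs
  | T + 1, w, s', o', hw, hs => by
      obtain ⟨w, ⟨s, o, m, a⟩, rfl⟩ : ∃ w' z, w = extend w' z :=
        ⟨_, _, (Fin.snoc_init_self w).symm⟩
      simp only [trajProb, stepProb, init_extend, extend_last] at hw
      simp only [stateProb, extend_last] at hs
      have ih := likelihoodBefore_mul_beliefBefore_ne_zero T w s o (left_ne_zero_of_mul hw)
        (left_ne_zero_of_mul (right_ne_zero_of_mul hw))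
      rw [map_extend (fun z : S × O × M × A => z.2), likelihoodBefore_mul_belief_extend hη hp hh]
      have hn : ∀ r, 0 ≤ likelihoodBefore η p h (fun i => (w i).2) o *
          beliefBefore η p h (fun i => (w i).2) o r * (p r a s' * η s' o') := fun r =>
        mul_nonneg (mul_nonneg (likelihood_nonneg hη hp hh _ _ _) (belief_nonneg hη hp hh _ _ _ _))
          (mul_nonneg ((hp r a).1 s') ((hη s').1 o'))
      intro h0
      exact mul_ne_zero ih hs
        ((Finset.sum_eq_zero_iff_of_nonneg fun r _ => hn r).1 h0 s (Finset.mem_univ _))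

/-- The law of a trajectory restricts to the law of its initial part. -/
lemma IsProper.expect_init (hA : IsProper η p h agent) (T : ℕ)
    (X : (Fin T → S × O × M × A) → ℝ) :
    expect η p h agent (T + 1) (fun w => X (Fin.init w)) = expect η p h agent T X := by
  unfold expect
  rw [sum_extend]
  refine Finset.sum_congr rfl fun w _ => ?_
  simp only [trajProb, init_extend, extend_last]
  rw [← Finset.sum_mul, ← Finset.mul_sum]
  congr 1
  by_cases hw : trajProb η p h agent T w = 0
  · rw [hw, zero_mul]
  suffices hs : ∑ z, stepProb η p h agent T w z = 1 by rw [hs, mul_one]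
  have hs : ∀ s o, ∑ m, ∑ a, stepProb η p h agent T w (s, o, m, a) =
      stateProb p h T w s * η s o := fun s o => by
    simp only [stepProb, ← Finset.mul_sum]
    by_cases h0 : stateProb p h T w s * η s o = 0
    · rw [h0, zero_mul]
    · have := likelihoodBefore_mul_beliefBefore_ne_zero hη hp hh T w s o hw h0
      rw [hA.sum_eq_one, mul_one]
      exact left_ne_zero_of_mul this
  simp_rw [Fintype.sum_prod_type, hs, ← Finset.mul_sum, (hη _).2, mul_one]
  exact (stateProb_mem hp hh T w).2

end

end Observed

section Bellman

variable {S A O M : Type*} [Fintype S] [Fintype A] [Fintype O] [Fintype M] [DecidableEq A]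
  {η : S → O → ℝ} {C : S → A → ℝ} {p : S → A → S → ℝ} {h : S → ℝ} {agent : Agent A O M}
  {H J : ℝ} {v : (S → ℝ) → ℝ} {π : (S → ℝ) → A}

/-- Expected cost accumulated before index `T`. -/
def cumCost (η : S → O → ℝ) (C : S → A → ℝ) (p : S → A → S → ℝ) (h : S → ℝ)
    (agent : Agent A O M) (T : ℕ) : ℝ :=
  expect η p h agent T (fun w => ∑ t, C (w t).1 (w t).2.2.2)

/-- Mean relative value of the belief at index `T`. -/
def meanValue (η : S → O → ℝ) (p : S → A → S → ℝ) (h : S → ℝ) (agent : Agent A O M)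
    (v : (S → ℝ) → ℝ) (T : ℕ) : ℝ :=
  obsExpect η p h agent T (fun x => v (beliefLast η p h x))

/-- Probability that the action at index `T` is not the one that `π` prescribes at the belief. -/
def deviationProb (η : S → O → ℝ) (p : S → A → S → ℝ) (h : S → ℝ) (agent : Agent A O M)
    (π : (S → ℝ) → A) (T : ℕ) : ℝ :=
  obsExpect η p h agent T (fun x => if lastAction x = π (beliefLast η p h x) then 0 else 1)

variable (hη : ∀ s, η s ∈ stdSimplex ℝ O) (hC : ∀ s a, C s a ∈ Set.Icc (0 : ℝ) 1)
  (hp : ∀ s a, p s a ∈ stdSimplex ℝ S)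

omit [Fintype A] [DecidableEq A] in
include hη hC hp in
lemma bellmanQ_mem_Icc {b : S → ℝ} (hb : b ∈ stdSimplex ℝ S)
    (hv0 : ∀ b ∈ stdSimplex ℝ S, 0 ≤ v b) (hvH : ∀ b ∈ stdSimplex ℝ S, v b ≤ H) (a : A) :
    bellmanQ η C p v b a ∈ Set.Icc 0 (1 + H) := by
  have h1 : ∀ s, 0 ≤ C s a * b s ∧ C s a * b s ≤ b s := fun s =>
    ⟨mul_nonneg (hC s a).1 (hb.1 s), mul_le_of_le_one_left (hb.1 s) (hC s a).2⟩
  have h2 : ∀ o, 0 ≤ obsProb η p b a o * v (beliefUpdate η p b a o) ∧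
      obsProb η p b a o * v (beliefUpdate η p b a o) ≤ obsProb η p b a o * H := fun o => by
    have hn := obsProb_nonneg hη hp hb.1 a o
    by_cases h0 : obsProb η p b a o = 0
    · simp [h0]
    · have := beliefUpdate_mem hη hp hb.1 h0
      exact ⟨mul_nonneg hn (hv0 _ this), mul_le_mul_of_nonneg_left (hvH _ this) hn⟩
  refine ⟨add_nonneg (Finset.sum_nonneg fun s _ => (h1 s).1)
    (Finset.sum_nonneg fun o _ => (h2 o).1), add_le_add ?_ ?_⟩
  · exact (Finset.sum_le_sum fun s _ => (h1 s).2).trans hb.2.le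
  · refine (Finset.sum_le_sum fun o _ => (h2 o).2).trans ?_
    rw [← Finset.sum_mul, sum_obsProb hη hp, hb.2, one_mul]

omit [Fintype A] [DecidableEq A] in
lemma IsBellmanSolution.eq_of_isGreedy (hB : IsBellmanSolution η C p H J v)
    (hπ : IsGreedy η C p v π) {b : S → ℝ} (hb : b ∈ stdSimplex ℝ S) :
    bellmanQ η C p v b (π b) = J + v b := by
  obtain ⟨⟨a, ha⟩, hle⟩ := hB.bellman b hb
  exact le_antisymm (ha ▸ hπ b hb a) (hle ⟨_, rfl⟩)

variable (hh : h ∈ stdSimplex ℝ S) (hB : IsBellmanSolution η C p H J v)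
  (hA : IsProper η p h agent)

omit [DecidableEq A] in
include hη hp hh hA in
lemma cumCost_succ (T : ℕ) :
    cumCost η C p h agent (T + 1) = cumCost η C p h agent T +
      obsExpect η p h agent T (fun x => ∑ s, C s (lastAction x) * beliefLast η p h x s) := by
  have h1 := expect_last (agent := agent) hη hp hh T fun x s => C s (lastAction x)
  have h2 := hA.expect_init hη hp hh T fun w => ∑ t, C (w t).1 (w t).2.2.2
  simp_rw [mul_comm (C _ _)]
  rw [← h1, cumCost, cumCost, ← h2]
  unfold expect
  rw [← Finset.sum_add_distrib]
  refine Finset.sum_congr rfl fun w _ => ?_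
  rw [← mul_add]
  exact congrArg _ (Fin.sum_univ_castSucc _)

omit [DecidableEq A] in
include hA in
lemma meanValue_succ (T : ℕ) :
    meanValue η p h agent v (T + 1) = obsExpect η p h agent T (fun x =>
      ∑ o, obsProb η p (beliefLast η p h x) (lastAction x) o *
        v (beliefUpdate η p (beliefLast η p h x) (lastAction x) o)) := by
  have h1 := preExpect_succ (η := η) (p := p) (h := h) (agent := agent) T
    fun x o => v (beliefUpdate η p (beliefLast η p h x) (lastAction x) o)
  rw [← h1, ← hA.obsExpect_eq_preExpect]
  rfl

omit [DecidableEq A] in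
include hη hp hh hA hB in
lemma meanValue_mem_Icc (T : ℕ) : meanValue η p h agent v T ∈ Set.Icc 0 H := by
  constructor
  · rw [← hA.obsExpect_const hη hp hh T 0]
    exact hA.obsExpect_mono hη hp hh fun x h0 => hB.nonneg _ (beliefLast_mem hη hp hh h0)
  · rw [← hA.obsExpect_const hη hp hh T H]
    exact hA.obsExpect_mono hη hp hh fun x h0 => hB.le_span _ (beliefLast_mem hη hp hh h0)

omit [DecidableEq A] in
include hη hp hh hA hB in
lemma meanValue_add_le (T : ℕ) :
    T * J + meanValue η p h agent v 0 ≤ cumCost η C p h agent T + meanValue η p h agent v T := by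
  induction T with
  | zero => simp [cumCost, expect]
  | succ T ih =>
    have hs : J + meanValue η p h agent v T ≤ obsExpect η p h agent T
        (fun x => bellmanQ η C p v (beliefLast η p h x) (lastAction x)) := by
      rw [meanValue, ← hA.obsExpect_const hη hp hh T J, ← obsExpect_add]
      refine hA.obsExpect_mono hη hp hh fun x h0 => ?_
      exact (hB.bellman _ (beliefLast_mem hη hp hh h0)).2 ⟨_, rfl⟩
    rw [cumCost_succ hη hp hh hA, meanValue_succ hA, add_assoc, ← obsExpect_add]
    unfold bellmanQ at hs
    push_cast
    linarith

include hη hC hp hh hA hB in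
lemma cumCost_add_meanValue_le (hπ : IsGreedy η C p v π) (T : ℕ) :
    cumCost η C p h agent T + meanValue η p h agent v T ≤ T * J + meanValue η p h agent v 0 +
      (1 + H) * ∑ t ∈ Finset.range T, deviationProb η p h agent π t := by
  induction T with
  | zero => simp [cumCost, expect]
  | succ T ih =>
    have hs : obsExpect η p h agent T
        (fun x => bellmanQ η C p v (beliefLast η p h x) (lastAction x)) ≤
        J + meanValue η p h agent v T + (1 + H) * deviationProb η p h agent π T := by
      have hJ := hA.obsExpect_const hη hp hh T J
      rw [meanValue, deviationProb, ← obsExpect_const_mul]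
      nth_rewrite 1 [← hJ]
      rw [← obsExpect_add, ← obsExpect_add]
      refine hA.obsExpect_mono hη hp hh fun x h0 => ?_
      have hb := beliefLast_mem hη hp hh h0
      split_ifs with ha
      · rw [ha, hB.eq_of_isGreedy hπ hb, mul_zero, add_zero]
      · rw [← hB.eq_of_isGreedy hπ hb, mul_one]
        have h1 := bellmanQ_mem_Icc hη hC hp hb hB.nonneg hB.le_span (lastAction x)
        have h2 := bellmanQ_mem_Icc hη hC hp hb hB.nonneg hB.le_span (π (beliefLast η p h x))
        linarith [h1.2, h2.1]
    rw [cumCost_succ hη hp hh hA, meanValue_succ hA, add_assoc, ← obsExpect_add,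
      Finset.sum_range_succ]
    unfold bellmanQ at hs
    push_cast
    linarith

include hη hp hh hA hB in
omit [DecidableEq A] in
lemma le_cumCost (T : ℕ) : T * J - H ≤ cumCost η C p h agent T := by
  have h1 := meanValue_add_le hη hp hh hB hA T
  have h2 := meanValue_mem_Icc hη hp hh hB hA T
  have h3 := meanValue_mem_Icc hη hp hh hB hA 0
  linarith [h2.2, h3.1]

include hη hC hp hh hA hB in
lemma cumCost_le (hπ : IsGreedy η C p v π) (T : ℕ) : cumCost η C p h agent T ≤
    T * J + H + (1 + H) * ∑ t ∈ Finset.range T, deviationProb η p h agent π t := by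
  have h1 := cumCost_add_meanValue_le hη hC hp hh hB hA hπ T
  have h2 := meanValue_mem_Icc hη hp hh hB hA T
  have h3 := meanValue_mem_Icc hη hp hh hB hA 0
  linarith [h2.1, h3.2]

include hη hC hp hh hA in
omit [DecidableEq A] in
lemma cumCost_le_card (T : ℕ) : cumCost η C p h agent T ≤ T := by
  induction T with
  | zero => simp [cumCost, expect]
  | succ T ih =>
    rw [cumCost_succ hη hp hh hA]
    push_cast
    refine add_le_add ih ?_
    rw [← hA.obsExpect_const hη hp hh T 1]
    refine hA.obsExpect_mono hη hp hh fun x h0 => ?_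
    have hb := beliefLast_mem hη hp hh h0
    exact (Finset.sum_le_sum fun s _ => mul_le_of_le_one_left (hb.1 s) (hC s _).2).trans hb.2.le

omit [Fintype O] in
lemma isProper_stationaryAgent (π : (S → ℝ) → A) :
    IsProper η p h (stationaryAgent η p h π) where
  nonneg T o m a m' a' := by unfold stationaryAgent; positivity
  sum_eq_one T o m a _ := by simp [stationaryAgent]

lemma deviationProb_stationaryAgent (π : (S → ℝ) → A) (T : ℕ) :
    deviationProb η p h (stationaryAgent η p h π) π T = 0 := by
  simp only [deviationProb, obsExpect, preExpect, preSum, lastAction_extend, beliefLast_extend]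
  refine Finset.sum_eq_zero fun y _ => mul_eq_zero_of_right _ <| Finset.sum_eq_zero fun o _ =>
    mul_eq_zero_of_right _ <| Finset.sum_eq_zero fun m _ => Finset.sum_eq_zero fun a _ => ?_
  simp only [draw, stationaryAgent, beliefBefore]
  split_ifs <;> simp [*]

include hη hC hp hh hB in
lemma le_avgCost (π : (S → ℝ) → A) : J ≤ avgCost η C p h π := by
  have hA := isProper_stationaryAgent (η := η) (p := p) (h := h) π
  have hlim : Tendsto (fun T : ℕ => J - H / (T : ℝ)) atTop (𝓝 J) := by
    simpa using tendsto_const_nhds.sub (tendsto_const_div_atTop_nhds_zero_nat H)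
  rw [← hlim.limsup_eq]
  refine limsup_le_limsup ?_ hlim.isCoboundedUnder_le ?_
  · filter_upwards [eventually_gt_atTop 0] with T hT
    have hT' : (0 : ℝ) < T := by exact_mod_cast hT
    have h1 := le_cumCost hη hp hh hB hA T
    rw [one_div, ← div_eq_inv_mul, le_div_iff₀ hT', sub_mul, div_mul_cancel₀ _ hT'.ne']
    unfold cumCost at h1
    linarith
  · refine ⟨1, eventually_map.2 ?_⟩
    filter_upwards [eventually_gt_atTop 0] with T hT
    have hT' : (0 : ℝ) < T := by exact_mod_cast hT
    rw [one_div, ← div_eq_inv_mul, div_le_one hT']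
    exact cumCost_le_card hη hC hp hh hA T

include hη hC hp hh hB in
lemma avgCost_eq_of_isGreedy (hπ : IsGreedy η C p v π) : avgCost η C p h π = J := by
  have hA := isProper_stationaryAgent (η := η) (p := p) (h := h) π
  refine Tendsto.limsup_eq ?_
  have hlim : ∀ c : ℝ, Tendsto (fun T : ℕ => J + c / (T : ℝ)) atTop (𝓝 J) := fun c => by
    simpa using tendsto_const_nhds.add (tendsto_const_div_atTop_nhds_zero_nat c)
  refine tendsto_of_tendsto_of_tendsto_of_le_of_le' (hlim (-H)) (hlim H) ?_ ?_
  · filter_upwards [eventually_gt_atTop 0] with T hT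
    have hT' : (0 : ℝ) < T := by exact_mod_cast hT
    have h1 := le_cumCost hη hp hh hB hA T
    rw [one_div, ← div_eq_inv_mul, le_div_iff₀ hT', add_mul, div_mul_cancel₀ _ hT'.ne']
    unfold cumCost at h1
    linarith
  · filter_upwards [eventually_gt_atTop 0] with T hT
    have hT' : (0 : ℝ) < T := by exact_mod_cast hT
    have h1 := cumCost_le hη hC hp hh hB hA hπ T
    simp only [deviationProb_stationaryAgent, Finset.sum_const_zero, mul_zero, add_zero] at h1
    rw [one_div, ← div_eq_inv_mul, div_le_iff₀ hT', add_mul, div_mul_cancel₀ _ hT'.ne']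
    unfold cumCost at h1
    linarith

include hη hC hp hh hB in
/-- The constant of the Bellman equation is the optimal long-term average cost. -/
theorem optCost_eq (hπ : IsGreedy η C p v π) : optCost η C p h = J := by
  have : Nonempty ((S → ℝ) → A) := ⟨π⟩
  refine le_antisymm ?_ (le_ciInf fun π' => le_avgCost hη hC hp hh hB π')
  rw [← avgCost_eq_of_isGreedy hη hC hp hh hB hπ]
  exact ciInf_le ⟨J, Set.forall_mem_range.2 fun π' => le_avgCost hη hC hp hh hB π'⟩ π

end Bellman

section Affinity

variable {O : Type*} [Fintype O]

lemma mul_log_div_le {x y d : ℝ} (hx : 0 ≤ x) (hy : 0 < y) (hxy : x ≤ Real.exp d * y) :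
    x * Real.log (x / y) ≤ 2 * Real.exp (d / 2) * (√x * |√x - √y|) := by
  rcases hx.eq_or_lt with rfl | hx
  · simp
  have hr := Real.sqrt_pos.2 hx
  have hs := Real.sqrt_pos.2 hy
  have hc : √x / √y ≤ Real.exp (d / 2) := by
    rw [div_le_iff₀ hs, Real.exp_half, ← Real.sqrt_mul (Real.exp_pos d).le]
    exact Real.sqrt_le_sqrt hxy
  have hlog : Real.log (x / y) = 2 * Real.log (√x / √y) := by
    rw [← Real.sqrt_div hx.le, Real.log_sqrt (by positivity)]
    ring
  have hle := Real.log_le_sub_one_of_pos (div_pos hr hs)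
  calc x * Real.log (x / y) ≤ x * (2 * (√x / √y - 1)) := by
        rw [hlog]; gcongr
    _ = 2 * (√x / √y) * (√x * (√x - √y)) := by
        nth_rewrite 1 [← Real.mul_self_sqrt hx.le]
        field_simp
    _ ≤ 2 * (√x / √y) * (√x * |√x - √y|) := by
        gcongr; exact le_abs_self _
    _ ≤ 2 * Real.exp (d / 2) * (√x * |√x - √y|) := by gcongr

lemma sum_sqrt_mul_eq {μ ν : O → ℝ} (hμ : μ ∈ stdSimplex ℝ O) (hν : ν ∈ stdSimplex ℝ O) :
    ∑ o, √(ν o * μ o) = 1 - (∑ o, (√(μ o) - √(ν o)) ^ 2) / 2 := by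
  have h1 : ∀ o, (√(μ o) - √(ν o)) ^ 2 = μ o + ν o - 2 * √(ν o * μ o) := fun o => by
    rw [sub_sq, Real.sq_sqrt (hμ.1 o), Real.sq_sqrt (hν.1 o), Real.sqrt_mul (hν.1 o)]
    ring
  simp_rw [h1, Finset.sum_sub_distrib, Finset.sum_add_distrib, hμ.2, hν.2, ← Finset.mul_sum]
  ring

/-- Under bounded likelihood ratios, a lower bound on the divergence keeps the Hellinger affinity
away from one. -/
lemma exists_affinity_bound (O : Type*) [Fintype O] {ε : ℝ} (d : ℝ) (hε : 0 < ε) :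
    ∃ ρ : ℝ, 0 < ρ ∧ ρ < 1 ∧ ∀ μ ∈ stdSimplex ℝ O, ∀ ν ∈ stdSimplex ℝ O,
      (ε : EReal) ≤ kl μ ν →
      (∀ o, (ν o ≠ 0 → μ o ≤ Real.exp d * ν o) ∧
        (ν o = 0 → μ o = 0 ∨ Real.exp (-d) ≤ μ o)) → ∑ o, √(ν o * μ o) ≤ ρ := by
  set δ := min (Real.exp (-d)) (ε ^ 2 / (4 * Real.exp d)) with hδ
  have hδ0 : 0 < δ := lt_min (Real.exp_pos _) (by positivity)
  refine ⟨max (1 / 2) (1 - δ / 2), lt_max_of_lt_left (by norm_num),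
    max_lt (by norm_num) (by linarith), fun μ hμ ν hν hkl hr => le_max_of_le_right ?_⟩
  rw [sum_sqrt_mul_eq hμ hν]
  suffices δ ≤ ∑ o, (√(μ o) - √(ν o)) ^ 2 by linarith
  unfold kl at hkl
  split_ifs at hkl with hac
  · refine (min_le_right _ _).trans ?_
    rw [EReal.coe_le_coe_iff] at hkl
    have hle : ε ≤ 2 * Real.exp (d / 2) * ∑ o, √(μ o) * |√(μ o) - √(ν o)| := by
      refine hkl.trans ?_
      rw [Finset.mul_sum]
      refine Finset.sum_le_sum fun o _ => ?_
      by_cases h0 : ν o = 0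
      · rw [hac o h0]; simp
      · exact mul_log_div_le (hμ.1 o) ((hν.1 o).lt_of_ne' h0) ((hr o).1 h0)
    have hcs := Finset.sum_mul_sq_le_sq_mul_sq Finset.univ (fun o => √(μ o))
      (fun o => |√(μ o) - √(ν o)|)
    simp_rw [Real.sq_sqrt (hμ.1 _), hμ.2, one_mul, sq_abs] at hcs
    rw [div_le_iff₀ (by positivity)]
    calc ε ^ 2 ≤ (2 * Real.exp (d / 2) * ∑ o, √(μ o) * |√(μ o) - √(ν o)|) ^ 2 := by gcongr
      _ = 4 * Real.exp d * (∑ o, √(μ o) * |√(μ o) - √(ν o)|) ^ 2 := by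
          rw [mul_pow, mul_pow, ← Real.exp_nat_mul]
          push_cast
          rw [mul_div_cancel₀ d two_ne_zero]
          norm_num
      _ ≤ 4 * Real.exp d * ∑ o, (√(μ o) - √(ν o)) ^ 2 := by gcongr
      _ = _ := mul_comm _ _
  · refine (min_le_left _ _).trans ?_
    push Not at hac
    obtain ⟨o, h0, h1⟩ := hac
    have h2 := ((hr o).2 h0).resolve_left h1
    calc Real.exp (-d) ≤ (√(μ o) - √(ν o)) ^ 2 := by
          rw [h0, Real.sqrt_zero, sub_zero, Real.sq_sqrt (hμ.1 o)]; exact h2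
      _ ≤ _ := Finset.single_le_sum (f := fun o => (√(μ o) - √(ν o)) ^ 2)
          (fun _ _ => sq_nonneg _) (Finset.mem_univ o)

end Affinity

section Posterior

variable {S A O Θ : Type*} [Fintype S] [Fintype O] [Fintype Θ]
  {η : S → O → ℝ} {P : Θ → S → A → S → ℝ} {h : Θ → S → ℝ} {f : Θ → ℝ}
  (hη : ∀ s, η s ∈ stdSimplex ℝ O) (hP : ∀ θ s a, P θ s a ∈ stdSimplex ℝ S)
  (hh : ∀ θ, h θ ∈ stdSimplex ℝ S) (hf : f ∈ stdSimplex ℝ Θ)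
include hη hP hh hf

/-- Bayes' formula. -/
lemma posterior_eq : ∀ (t : ℕ) (o : Fin (t + 1) → O) (a : Fin t → A) (θ : Θ),
    posterior η P h f t o a θ = likelihood η (P θ) (h θ) t o a * f θ /
      ∑ γ, likelihood η (P γ) (h γ) t o a * f γ
  | 0, _, _, _ => rfl
  | t + 1, o, a, θ => by
      simp only [posterior, likelihood, posterior_eq t]
      set L := fun γ => likelihood η (P γ) (h γ) t (Fin.init o) (Fin.init a) with hL
      set ν := fun γ => predictive η (P γ) (h γ) t (Fin.init o) (Fin.init a) (a (Fin.last t))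
        (o (Fin.last (t + 1))) with hν
      change ν θ * (L θ * f θ / ∑ γ, L γ * f γ) / ∑ γ, ν γ * (L γ * f γ / ∑ γ, L γ * f γ) =
        L θ * ν θ * f θ / ∑ γ, L γ * ν γ * f γ
      have hn : ∀ γ ∈ Finset.univ, 0 ≤ L γ * f γ := fun γ _ =>
        mul_nonneg (likelihood_nonneg hη (hP γ) (hh γ) t _ _) (hf.1 γ)
      by_cases h0 : ∑ γ, L γ * f γ = 0
      · have h1 := (Finset.sum_eq_zero_iff_of_nonneg hn).1 h0 θ (Finset.mem_univ _)
        rw [h1, mul_right_comm, h1]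
        simp
      · simp_rw [← mul_div_assoc, ← Finset.sum_div]
        rw [div_div_div_cancel_right₀ h0]
        congr 1
        · ring
        · exact Finset.sum_congr rfl fun γ _ => by ring

lemma posterior_nonneg (t : ℕ) (o : Fin (t + 1) → O) (a : Fin t → A) (θ : Θ) :
    0 ≤ posterior η P h f t o a θ := by
  rw [posterior_eq hη hP hh hf]
  exact div_nonneg (mul_nonneg (likelihood_nonneg hη (hP θ) (hh θ) t _ _) (hf.1 θ))
    (Finset.sum_nonneg fun γ _ =>
      mul_nonneg (likelihood_nonneg hη (hP γ) (hh γ) t _ _) (hf.1 γ))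

lemma sum_posterior {θ : Θ} (hθ : 0 < f θ) {t : ℕ} {o : Fin (t + 1) → O} {a : Fin t → A}
    (h0 : likelihood η (P θ) (h θ) t o a ≠ 0) : ∑ γ, posterior η P h f t o a γ = 1 := by
  simp_rw [posterior_eq hη hP hh hf, ← Finset.sum_div]
  refine div_self fun hs => ?_
  have := (Finset.sum_eq_zero_iff_of_nonneg fun γ _ =>
    mul_nonneg (likelihood_nonneg hη (hP γ) (hh γ) t o a) (hf.1 γ)).1 hs θ (Finset.mem_univ _)
  exact mul_ne_zero h0 hθ.ne' this

lemma likelihood_mul_posterior_le {θ γ : Θ} (hθ : 0 < f θ) (hγ : γ ≠ θ) (t : ℕ)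
    (o : Fin (t + 1) → O) (a : Fin t → A) :
    likelihood η (P θ) (h θ) t o a * posterior η P h f t o a γ ≤
      (f θ)⁻¹ * √(likelihood η (P γ) (h γ) t o a * likelihood η (P θ) (h θ) t o a) := by
  classical
  rw [posterior_eq hη hP hh hf]
  set L := fun γ => likelihood η (P γ) (h γ) t o a with hL
  change L θ * (L γ * f γ / ∑ γ, L γ * f γ) ≤ (f θ)⁻¹ * √(L γ * L θ)
  have hL0 : ∀ γ, 0 ≤ L γ := fun γ => likelihood_nonneg hη (hP γ) (hh γ) t _ _
  have hn : ∀ γ ∈ Finset.univ, 0 ≤ L γ * f γ := fun γ _ => mul_nonneg (hL0 γ) (hf.1 γ)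
  have hsum : L γ * f γ + L θ * f θ ≤ ∑ γ, L γ * f γ := by
    rw [← Finset.sum_pair (f := fun γ => L γ * f γ) hγ]
    exact Finset.sum_le_sum_of_subset_of_nonneg (Finset.subset_univ _) fun γ hγ _ =>
      hn γ (Finset.mem_univ _)
  have hf1 : ∀ γ, f γ ≤ 1 := fun γ =>
    hf.2 ▸ Finset.single_le_sum (fun γ _ => hf.1 γ) (Finset.mem_univ γ)
  have hx : 0 ≤ L γ * f γ := hn γ (Finset.mem_univ _)
  have hy : 0 ≤ L θ * f θ := hn θ (Finset.mem_univ _)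
  have hsq : √((L γ * f γ) * (L θ * f θ)) ≤ ∑ γ, L γ * f γ := by
    refine (Real.sqrt_le_iff.2 ⟨add_nonneg hx hy, ?_⟩).trans hsum
    nlinarith
  have hle : √((L γ * f γ) * (L θ * f θ)) ≤ √(L γ * L θ) := by
    apply Real.sqrt_le_sqrt
    exact mul_le_mul (mul_le_of_le_one_right (hL0 _) (hf1 _))
      (mul_le_of_le_one_right (hL0 _) (hf1 _)) hy (hL0 _)
  have hS : 0 ≤ ∑ γ, L γ * f γ := Finset.sum_nonneg hn
  rw [inv_mul_eq_div, le_div_iff₀ hθ]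
  calc L θ * (L γ * f γ / ∑ γ, L γ * f γ) * f θ
      = √((L γ * f γ) * (L θ * f θ)) * √((L γ * f γ) * (L θ * f θ)) / ∑ γ, L γ * f γ := by
        rw [Real.mul_self_sqrt (mul_nonneg hx hy)]; ring
    _ ≤ √((L γ * f γ) * (L θ * f θ)) := by
        rcases hS.eq_or_lt with h0 | h0
        · rw [← h0, div_zero]; exact Real.sqrt_nonneg _
        · rw [div_le_iff₀ h0]
          exact mul_le_mul_of_nonneg_left hsq (Real.sqrt_nonneg _)
    _ ≤ _ := hle

end Posterior

section Sampling

variable {S A O Θ : Type*} [Fintype S] [Fintype A] [Fintype O] [Fintype Θ] [DecidableEq A]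
  [DecidableEq Θ]
  {η : S → O → ℝ} {P : Θ → S → A → S → ℝ} {h : Θ → S → ℝ} {f : Θ → ℝ} {π : Θ → (S → ℝ) → A}
  {sched : ℕ → ℕ → ℕ} {m : ℕ → S → A → ℕ}

omit [Fintype A] [Fintype O] [DecidableEq A] in
lemma paramProb_of_start {t : ℕ} (ht : (episode sched m t).1 = t + 1) (o : Fin (t + 1) → O)
    (ϑ : Fin t → Θ) (a : Fin t → A) :
    paramProb η P h f sched m t o ϑ a = posterior η P h f t o a := by
  cases t with
  | zero => rfl
  | succ t => funext θ; exact if_pos ht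

omit [Fintype A] [Fintype O] [DecidableEq A] in
lemma paramProb_of_not_start {t : ℕ} (ht : (episode sched m (t + 1)).1 ≠ t + 2)
    (o : Fin (t + 2) → O) (ϑ : Fin (t + 1) → Θ) (a : Fin (t + 1) → A) (θ : Θ) :
    paramProb η P h f sched m (t + 1) o ϑ a θ = if θ = ϑ (Fin.last t) then 1 else 0 :=
  if_neg ht

omit [Fintype O] in
lemma sum_draw_psrlAgent_mul {T : ℕ} (y : Fin T → O × Θ × A) (o : O) (g : Θ → ℝ) :
    ∑ θ, ∑ a, draw (psrlAgent η P h f π sched m) y o θ a * g θ =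
      ∑ θ, paramProb η P h f sched m T (extend (fun i => (y i).1) o) (fun i => (y i).2.1)
        (fun i => (y i).2.2) θ * g θ := by
  refine Finset.sum_congr rfl fun θ _ => ?_
  rw [← Finset.sum_mul]
  simp [draw, psrlAgent]

variable (hη : ∀ s, η s ∈ stdSimplex ℝ O) (hP : ∀ θ s a, P θ s a ∈ stdSimplex ℝ S)
  (hh : ∀ θ, h θ ∈ stdSimplex ℝ S) (hf : f ∈ stdSimplex ℝ Θ)

include hη hP hh hf in
lemma isProper_psrlAgent {θ : Θ} (hθ : 0 < f θ) :
    IsProper η (P θ) (h θ) (psrlAgent η P h f π sched m) where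
  nonneg T o ϑ a γ a' := by
    refine mul_nonneg ?_ (by positivity)
    by_cases ht : (episode sched m T).1 = T + 1
    · rw [paramProb_of_start ht]
      exact posterior_nonneg hη hP hh hf T o a γ
    · cases T with
      | zero => exact absurd rfl ht
      | succ T => rw [paramProb_of_not_start ht]; positivity
  sum_eq_one T o ϑ a h0 := by
    simp only [psrlAgent, ← Finset.mul_sum, Finset.sum_ite_eq', Finset.mem_univ,
      if_true, mul_one]
    by_cases ht : (episode sched m T).1 = T + 1
    · rw [paramProb_of_start ht]
      exact sum_posterior hη hP hh hf hθ h0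
    · cases T with
      | zero => exact absurd rfl ht
      | succ T => simp [paramProb_of_not_start ht]

/-- Probability, under the true parameter `θ`, that `γ` is the parameter in use at index `T`. -/
def useProb (η : S → O → ℝ) (P : Θ → S → A → S → ℝ) (h : Θ → S → ℝ) (f : Θ → ℝ)
    (π : Θ → (S → ℝ) → A) (sched : ℕ → ℕ → ℕ) (m : ℕ → S → A → ℕ) (θ γ : Θ) (T : ℕ) : ℝ :=
  obsExpect η (P θ) (h θ) (psrlAgent η P h f π sched m) T
    (fun x => if lastAux x = γ then 1 else 0)

lemma useProb_eq (θ γ : Θ) (T : ℕ) :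
    useProb η P h f π sched m θ γ T =
      preExpect η (P θ) (h θ) (psrlAgent η P h f π sched m) T fun y o =>
        paramProb η P h f sched m T (extend (fun i => (y i).1) o) (fun i => (y i).2.1)
          (fun i => (y i).2.2) γ := by
  unfold useProb obsExpect
  congr 1
  funext y o
  simp only [lastAux_extend]
  rw [sum_draw_psrlAgent_mul y o fun θ => if θ = γ then 1 else 0]
  simp

include hη hP hh in
lemma useProb_succ_of_not_start (θ γ : Θ) {T : ℕ} (hT : (episode sched m (T + 1)).1 ≠ T + 2) :
    useProb η P h f π sched m θ γ (T + 1) = useProb η P h f π sched m θ γ T := by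
  rw [useProb_eq]
  simp only [paramProb_of_not_start hT]
  rw [preExpect_succ _ fun (x : Fin (T + 1) → O × Θ × A) _ =>
    if γ = (x (Fin.last T)).2.1 then (1 : ℝ) else 0]
  refine obsExpect_congr fun x h0 => ?_
  rw [← Finset.sum_mul, sum_obsProb hη (hP θ), (beliefLast_mem hη (hP θ) (hh θ) h0).2, one_mul]
  simp only [lastAux, eq_comm]

/-- Mean of the square root of the likelihood ratio of `γ` and the true parameter `θ`. -/
def affinity (η : S → O → ℝ) (P : Θ → S → A → S → ℝ) (h : Θ → S → ℝ) (agent : Agent A O Θ)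
    (θ γ : Θ) (T : ℕ) : ℝ :=
  preSum agent T fun y o =>
    √(likelihoodBefore η (P γ) (h γ) y o * likelihoodBefore η (P θ) (h θ) y o)

include hη hP hh hf in
lemma useProb_le_of_start {θ γ : Θ} (hθ : 0 < f θ) (hγ : γ ≠ θ) {T : ℕ}
    (hT : (episode sched m T).1 = T + 1) :
    useProb η P h f π sched m θ γ T ≤
      (f θ)⁻¹ * affinity η P h (psrlAgent η P h f π sched m) θ γ T := by
  rw [useProb_eq, affinity, ← preSum_const_mul]
  simp only [paramProb_of_start hT]
  exact (isProper_psrlAgent hη hP hh hf hθ).preSum_mono fun y o =>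
    likelihood_mul_posterior_le hη hP hh hf hθ hγ T _ _

omit [DecidableEq A] [DecidableEq Θ] in
include hη hP hh in
lemma affinity_succ_le {θ γ : Θ} {agent : Agent A O Θ} (hA : IsProper η (P θ) (h θ) agent)
    {ρ : ℝ} (hρ : ∀ (t : ℕ) (o : Fin (t + 1) → O) (a : Fin t → A) (a' : A),
      likelihood η (P θ) (h θ) t o a ≠ 0 → likelihood η (P γ) (h γ) t o a ≠ 0 →
        ∑ o', √(predictive η (P γ) (h γ) t o a a' o' * predictive η (P θ) (h θ) t o a a' o') ≤ ρ)
    (T : ℕ) : affinity η P h agent θ γ (T + 1) ≤ ρ * affinity η P h agent θ γ T := by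
  unfold affinity
  rw [preSum_succ, ← preSum_const_mul]
  refine hA.preSum_mono fun y o => ?_
  simp only [likelihoodBefore_extend]
  set Lγ := likelihoodBefore η (P γ) (h γ) y o with hLγ
  set Lθ := likelihoodBefore η (P θ) (h θ) y o with hLθ
  have hγ0 : 0 ≤ Lγ := likelihood_nonneg hη (hP γ) (hh γ) _ _ _
  have hθ0 : 0 ≤ Lθ := likelihood_nonneg hη (hP θ) (hh θ) _ _ _
  simp_rw [mul_mul_mul_comm Lγ _ Lθ, Real.sqrt_mul (mul_nonneg hγ0 hθ0), ← Finset.mul_sum]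
  by_cases h0 : Lγ * Lθ = 0
  · simp [h0]
  have hθ1 : Lθ ≠ 0 := right_ne_zero_of_mul h0
  calc _ ≤ ∑ m, ∑ a, draw agent y o m a * (√(Lγ * Lθ) * ρ) := by
        refine Finset.sum_le_sum fun m _ => Finset.sum_le_sum fun a _ =>
          mul_le_mul_of_nonneg_left (mul_le_mul_of_nonneg_left ?_ (Real.sqrt_nonneg _))
            (hA.nonneg _ _ _ _ _ _)
        exact hρ T _ _ a hθ1 (left_ne_zero_of_mul h0)
    _ = ρ * √(Lγ * Lθ) := by
        simp_rw [← Finset.sum_mul, hA.sum_draw hθ1]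
        ring

include hη hP hh hf in
lemma deviationProb_psrlAgent_le {θ : Θ} (hθ : 0 < f θ) (T : ℕ) :
    deviationProb η (P θ) (h θ) (psrlAgent η P h f π sched m) (π θ) T ≤
      ∑ γ ∈ Finset.univ.erase θ, useProb η P h f π sched m θ γ T := by
  have hA := isProper_psrlAgent (π := π) (sched := sched) (m := m) hη hP hh hf hθ
  unfold useProb
  rw [← obsExpect_sum]
  refine hA.preSum_mono fun y o => mul_le_mul_of_nonneg_left ?_
    (likelihood_nonneg hη (hP θ) (hh θ) _ _ _)
  refine Finset.sum_le_sum fun γ _ => Finset.sum_le_sum fun a _ => ?_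
  simp only [lastAction_extend, beliefLast_extend, lastAux_extend, Finset.sum_ite_eq, Finset.mem_erase, Finset.mem_univ, and_true]
  by_cases hγ : γ = θ
  · subst hγ
    simp only [draw, psrlAgent, beliefBefore]
    split_ifs <;> simp_all
  · rw [if_pos hγ]
    refine mul_le_mul_of_nonneg_left ?_ (hA.nonneg _ _ _ _ _ _)
    split_ifs <;> norm_num

end Sampling

section Doubling

variable {S A : Type*}

/-- Start of the episode of index `i` for the schedule `2 * t_k` and the pseudo-count `t`. -/
abbrev doublingStart (S A : Type*) (i : ℕ) : ℕ :=
  (episode (fun tk _ => 2 * tk) (fun t (_ : S) (_ : A) => t) i).1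

lemma doublingStart_succ (i : ℕ) :
    doublingStart S A (i + 1) = doublingStart S A i ∨ doublingStart S A (i + 1) = i + 2 := by
  unfold doublingStart
  rw [episode]
  split_ifs
  · exact Or.inl rfl
  · exact Or.inr rfl

lemma le_two_mul_doublingStart : ∀ i : ℕ, i + 1 ≤ 2 * doublingStart S A i
  | 0 => by simp [doublingStart, episode]
  | i + 1 => by
      unfold doublingStart
      rw [episode]
      split_ifs with hc
      · exact hc.1
      · simp only
        omega

end Doubling

section Regret

variable {S A O Θ : Type*} [Fintype S] [Fintype A] [Fintype O] [Fintype Θ] [DecidableEq A]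
  [DecidableEq Θ]
  {η : S → O → ℝ} {C : S → A → ℝ} {P : Θ → S → A → S → ℝ} {h : Θ → S → ℝ} {f : Θ → ℝ}
  {π : Θ → (S → ℝ) → A}
  (hη : ∀ s, η s ∈ stdSimplex ℝ O) (hP : ∀ θ s a, P θ s a ∈ stdSimplex ℝ S)
  (hh : ∀ θ, h θ ∈ stdSimplex ℝ S) (hf : f ∈ stdSimplex ℝ Θ)

omit [DecidableEq A] [DecidableEq Θ] in
lemma IsProper.expect_const {p : S → A → S → ℝ} {h : S → ℝ} {agent : Agent A O Θ}
    (hη : ∀ s, η s ∈ stdSimplex ℝ O) (hp : ∀ s a, p s a ∈ stdSimplex ℝ S)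
    (hh : h ∈ stdSimplex ℝ S) (hA : IsProper η p h agent) (c : ℝ) :
    ∀ T, expect η p h agent T (fun _ => c) = c
  | 0 => by simp [expect, trajProb]
  | T + 1 => (hA.expect_init hη hp hh T fun _ => c).trans (hA.expect_const hη hp hh c T)

include hη hP hh hf in
lemma regret_eq {θ : Θ} (hθ : 0 < f θ) (sched : ℕ → ℕ → ℕ) (m : ℕ → S → A → ℕ) (T : ℕ) :
    regret η C P h f π sched m θ T =
      cumCost η C (P θ) (h θ) (psrlAgent η P h f π sched m) T - T * optCost η C (P θ) (h θ) := by
  have hA := isProper_psrlAgent (π := π) (sched := sched) (m := m) hη hP hh hf hθ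
  rw [← hA.expect_const hη (hP θ) (hh θ) (T * optCost η C (P θ) (h θ)) T]
  unfold regret cumCost expect
  rw [← Finset.sum_sub_distrib]
  refine Finset.sum_congr rfl fun w _ => ?_
  simp [Finset.sum_sub_distrib, mul_sub]

omit [Fintype A] [Fintype Θ] [DecidableEq A] [DecidableEq Θ] in
include hη hP hh in
/-- The affinities of the predictive distributions are bounded away from one. -/
lemma exists_predictive_affinity_bound (hsep : KLSeparated η P h)
    (hbdd : BoundedLikelihoodRatios η P h) :
    ∃ ρ : ℝ, 0 < ρ ∧ ρ < 1 ∧ ∀ θ γ : Θ, γ ≠ θ →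
      ∀ (t : ℕ) (o : Fin (t + 1) → O) (a : Fin t → A) (a' : A),
        likelihood η (P θ) (h θ) t o a ≠ 0 → likelihood η (P γ) (h γ) t o a ≠ 0 →
          ∑ o', √(predictive η (P γ) (h γ) t o a a' o' * predictive η (P θ) (h θ) t o a a' o') ≤
            ρ := by
  obtain ⟨ε, hε, hkl⟩ := hsep
  obtain ⟨d, hd⟩ := hbdd
  obtain ⟨ρ, hρ0, hρ1, hρ⟩ := exists_affinity_bound O d hε
  refine ⟨ρ, hρ0, hρ1, fun θ γ hne t o a a' hθ hγ => ?_⟩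
  have hθ' := (likelihood_nonneg hη (hP θ) (hh θ) t o a).lt_of_ne' hθ
  have hγ' := (likelihood_nonneg hη (hP γ) (hh γ) t o a).lt_of_ne' hγ
  exact hρ _ ⟨predictive_nonneg hη (hP θ) (hh θ) t o a a', sum_predictive hη (hP θ) (hh θ) hθ a'⟩
    _ ⟨predictive_nonneg hη (hP γ) (hh γ) t o a a', sum_predictive hη (hP γ) (hh γ) hγ a'⟩
    (hkl θ γ hne.symm t o a a' hθ' hγ') (hd θ γ t o a a' hθ' hγ')

include hη hP hh hf in
/-- The probability of using a wrong parameter decays exponentially in the start of the current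
episode. -/
lemma useProb_le {θ γ : Θ} (hθ : 0 < f θ) (hγ : γ ≠ θ) {ρ : ℝ} (hρ0 : 0 < ρ)
    (hρ : ∀ (t : ℕ) (o : Fin (t + 1) → O) (a : Fin t → A) (a' : A),
      likelihood η (P θ) (h θ) t o a ≠ 0 → likelihood η (P γ) (h γ) t o a ≠ 0 →
        ∑ o', √(predictive η (P γ) (h γ) t o a a' o' * predictive η (P θ) (h θ) t o a a' o') ≤ ρ)
    {sched : ℕ → ℕ → ℕ} {m : ℕ → S → A → ℕ}
    (hep : ∀ i, (episode sched m (i + 1)).1 = (episode sched m i).1 ∨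
      (episode sched m (i + 1)).1 = i + 2) (i : ℕ) :
    useProb η P h f π sched m θ γ i ≤
      (f θ)⁻¹ * affinity η P h (psrlAgent η P h f π sched m) θ γ 0 *
        ρ ^ ((episode sched m i).1 - 1) := by
  have hA := isProper_psrlAgent (π := π) (sched := sched) (m := m) hη hP hh hf hθ
  have haff : ∀ T, affinity η P h (psrlAgent η P h f π sched m) θ γ T ≤
      affinity η P h (psrlAgent η P h f π sched m) θ γ 0 * ρ ^ T := fun T => by
    induction T with
    | zero => simp
    | succ T ih =>
      refine (affinity_succ_le hη hP hh hA hρ T).trans ?_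
      rw [pow_succ, ← mul_assoc, mul_comm]
      exact mul_le_mul_of_nonneg_right ih hρ0.le
  have hstart : ∀ T, (episode sched m T).1 = T + 1 → useProb η P h f π sched m θ γ T ≤
      (f θ)⁻¹ * affinity η P h (psrlAgent η P h f π sched m) θ γ 0 *
        ρ ^ ((episode sched m T).1 - 1) := fun T hT => by
    rw [hT, Nat.add_sub_cancel, mul_assoc]
    exact (useProb_le_of_start hη hP hh hf hθ hγ hT).trans
      (mul_le_mul_of_nonneg_left (haff T) (inv_pos.2 hθ).le)
  induction i with
  | zero => exact hstart 0 rfl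
  | succ i ih =>
    by_cases hs : (episode sched m (i + 1)).1 = i + 2
    · exact hstart (i + 1) hs
    · rw [useProb_succ_of_not_start hη hP hh θ γ hs, (hep i).resolve_right hs]
      exact ih

lemma sum_pow_le_of_le_two_mul {ρ : ℝ} (hρ0 : 0 < ρ) (hρ1 : ρ < 1) {k : ℕ → ℕ}
    (hk : ∀ i, i + 1 ≤ 2 * k i) (T : ℕ) :
    ∑ i ∈ Finset.range T, ρ ^ (k i - 1) ≤ (√ρ)⁻¹ * (1 - √ρ)⁻¹ := by
  have hσ0 : 0 < √ρ := Real.sqrt_pos.2 hρ0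
  have hσ1 : √ρ < 1 := by rw [Real.sqrt_lt' one_pos]; simpa using hρ1
  calc ∑ i ∈ Finset.range T, ρ ^ (k i - 1) ≤ ∑ i ∈ Finset.range T, (√ρ)⁻¹ * √ρ ^ i := by
        refine Finset.sum_le_sum fun i _ => ?_
        rw [inv_mul_eq_div, le_div_iff₀ hσ0]
        calc ρ ^ (k i - 1) * √ρ = √ρ ^ (2 * (k i - 1) + 1) := by
              rw [pow_succ, pow_mul, Real.sq_sqrt hρ0.le]
          _ ≤ √ρ ^ i := pow_le_pow_of_le_one hσ0.le hσ1.le (by have := hk i; omega)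
    _ = (√ρ)⁻¹ * ∑ i ∈ Finset.range T, √ρ ^ i := (Finset.mul_sum _ _ _).symm
    _ ≤ _ := by
        refine mul_le_mul_of_nonneg_left ?_ (inv_pos.2 hσ0).le
        rw [← tsum_geometric_of_lt_one hσ0.le hσ1]
        exact (summable_geometric_of_lt_one hσ0.le hσ1).sum_le_tsum _ fun i _ => by positivity

include hη hP hh hf in
/-- The expected number of deviations from the optimal policy is bounded. -/
lemma exists_sum_deviationProb_le (hsep : KLSeparated η P h)
    (hbdd : BoundedLikelihoodRatios η P h) {θ : Θ} (hθ : 0 < f θ) :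
    ∃ K : ℝ, 0 ≤ K ∧ ∀ T : ℕ, ∑ t ∈ Finset.range T, deviationProb η (P θ) (h θ)
      (psrlAgent η P h f π (fun tk _ => 2 * tk) (fun t _ _ => t)) (π θ) t ≤ K := by
  obtain ⟨ρ, hρ0, hρ1, hρ⟩ := exists_predictive_affinity_bound hη hP hh hsep hbdd
  set agent := psrlAgent η P h f π (fun tk _ => 2 * tk) (fun t _ _ => t) with hagent
  set c := ∑ γ ∈ Finset.univ.erase θ, (f θ)⁻¹ * affinity η P h agent θ γ 0 with hc
  have hc0 : 0 ≤ c := Finset.sum_nonneg fun γ _ => mul_nonneg (inv_pos.2 hθ).le <| by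
    unfold affinity preSum
    exact Finset.sum_nonneg fun y _ => mul_nonneg zero_le_one <|
      Finset.sum_nonneg fun o _ => Real.sqrt_nonneg _
  have hdev : ∀ t, deviationProb η (P θ) (h θ) agent (π θ) t ≤
      c * ρ ^ (doublingStart S A t - 1) := fun t => by
    refine (deviationProb_psrlAgent_le hη hP hh hf hθ t).trans ?_
    rw [hc, Finset.sum_mul]
    exact Finset.sum_le_sum fun γ hγ => useProb_le hη hP hh hf hθ (Finset.ne_of_mem_erase hγ) hρ0
      (hρ θ γ (Finset.ne_of_mem_erase hγ)) doublingStart_succ t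
  have hσ1 : √ρ < 1 := by rw [Real.sqrt_lt' one_pos]; simpa using hρ1
  refine ⟨c * ((√ρ)⁻¹ * (1 - √ρ)⁻¹), mul_nonneg hc0 (mul_nonneg (by positivity)
    (inv_nonneg.2 (by linarith))), fun T => ?_⟩
  refine (Finset.sum_le_sum fun t _ => hdev t).trans ?_
  rw [← Finset.mul_sum]
  exact mul_le_mul_of_nonneg_left
    (sum_pow_le_of_le_two_mul hρ0 hρ1 le_two_mul_doublingStart T) hc0

include hη hP hh hf in
/-- The regret of PSRL-POMDP is bounded for each true parameter. -/
theorem exists_abs_regret_le (hC : ∀ s a, C s a ∈ Set.Icc (0 : ℝ) 1) {H : ℝ} {J : Θ → ℝ}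
    {v : Θ → (S → ℝ) → ℝ} (hBellman : ∀ θ, IsBellmanSolution η C (P θ) H (J θ) (v θ))
    (hπ : ∀ θ, IsGreedy η C (P θ) (v θ) (π θ)) (hsep : KLSeparated η P h)
    (hbdd : BoundedLikelihoodRatios η P h) {θ : Θ} (hθ : 0 < f θ) :
    ∃ K : ℝ, ∀ T : ℕ,
      |regret η C P h f π (fun tk _ => 2 * tk) (fun t _ _ => t) θ T| ≤ K := by
  obtain ⟨K, hK0, hK⟩ := exists_sum_deviationProb_le (π := π) hη hP hh hf hsep hbdd hθ
  have hH : 0 ≤ H := ((hBellman θ).nonneg _ (hh θ)).trans ((hBellman θ).le_span _ (hh θ))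
  refine ⟨H + (1 + H) * K, fun T => ?_⟩
  have hA := isProper_psrlAgent (π := π) (sched := fun tk _ => 2 * tk)
    (m := fun t (_ : S) (_ : A) => t) hη hP hh hf hθ
  rw [regret_eq hη hP hh hf hθ, optCost_eq hη hC (hP θ) (hh θ) (hBellman θ) (hπ θ), abs_le]
  have h1 := le_cumCost hη (hP θ) (hh θ) (hBellman θ) hA T
  have h2 := cumCost_le hη hC (hP θ) (hh θ) (hBellman θ) hA (hπ θ) T
  have h3 := mul_le_mul_of_nonneg_left (hK T) (by linarith : 0 ≤ 1 + H)
  have h4 : 0 ≤ (1 + H) * K := mul_nonneg (by linarith) hK0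
  constructor <;> linarith

end Regret

end

end PsrlPomdp

theorem mainTheorem2 {S A O Θ : Type*} [Fintype S] [Fintype A] [Fintype O] [Fintype Θ]
    [DecidableEq A] [DecidableEq Θ]
    (η : S → O → ℝ) (C : S → A → ℝ) (P : Θ → S → A → S → ℝ) (h : Θ → S → ℝ) (f : Θ → ℝ)
    (H : ℝ) (J : Θ → ℝ) (v : Θ → (S → ℝ) → ℝ) (π : Θ → (S → ℝ) → A)
    (hη : ∀ s, η s ∈ stdSimplex ℝ O)
    (hC : ∀ s a, C s a ∈ Set.Icc (0 : ℝ) 1)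
    (hP : ∀ θ s a, P θ s a ∈ stdSimplex ℝ S)
    (hh : ∀ θ, h θ ∈ stdSimplex ℝ S)
    (hf : f ∈ stdSimplex ℝ Θ)
    (hBellman : ∀ θ, PsrlPomdp.IsBellmanSolution η C (P θ) H (J θ) (v θ))
    (hπ : ∀ θ, PsrlPomdp.IsGreedy η C (P θ) (v θ) (π θ))
    (hsep : PsrlPomdp.KLSeparated η P h)
    (hbdd : PsrlPomdp.BoundedLikelihoodRatios η P h) :
    ∃ K : ℝ, ∀ θ : Θ, 0 < f θ → ∀ T : ℕ, 1 ≤ T →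
      |PsrlPomdp.regret η C P h f π (fun tk _ => 2 * tk) (fun t _ _ => t) θ T| ≤
        H * Real.logb 2 T + K := by
  have hex : ∀ θ, ∃ K : ℝ, 0 < f θ → ∀ T : ℕ,
      |PsrlPomdp.regret η C P h f π (fun tk _ => 2 * tk) (fun t _ _ => t) θ T| ≤ K := fun θ => by
    by_cases hθ : 0 < f θ
    · obtain ⟨K, hK⟩ := PsrlPomdp.exists_abs_regret_le hη hP hh hf hC hBellman hπ hsep hbdd hθ
      exact ⟨K, fun _ => hK⟩
    · exact ⟨0, fun h0 => absurd h0 hθ⟩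
  choose K hK using hex
  refine ⟨∑ θ, |K θ|, fun θ hθ T hT => ?_⟩
  have hH : 0 ≤ H := ((hBellman θ).nonneg _ (hh θ)).trans ((hBellman θ).le_span _ (hh θ))
  have hlog : 0 ≤ Real.logb 2 T := Real.logb_nonneg one_lt_two (by exact_mod_cast hT)
  calc |PsrlPomdp.regret η C P h f π (fun tk _ => 2 * tk) (fun t _ _ => t) θ T|
      ≤ K θ := hK θ hθ T
    _ ≤ |K θ| := le_abs_self _
    _ ≤ ∑ θ, |K θ| := Finset.single_le_sum (f := fun θ => |K θ|) (fun _ _ => abs_nonneg _)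
        (Finset.mem_univ θ)
    _ ≤ H * Real.logb 2 T + ∑ θ, |K θ| := le_add_of_nonneg_left (mul_nonneg hH hlog)
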